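/- Let $n>1$ and let $M$ be a smooth (Hausdorff) manifold of dimension $2n+1$ with a paraSasakian structure $(\varphi,\xi,\eta,g)$. That is, $\varphi$ is a smooth $(1,1)$-tensor field, $\xi$ a smooth vector field, $\eta$ a smooth 1-form and $g$ a smooth pseudo-Riemannian metric on $M$ such that, for all vector fields $X,Y$, $$\varphi\xi=0,\quad \eta\circ\varphi=0,\quad \eta(\xi)=1,\quad \varphi^2=\mathrm{id}-\eta\otimes\xi,\quad g(\varphi X,\varphi Y)=-g(X,Y)+\eta(X)\eta(Y),\quad g(X,\varphi Y)=d\eta(X,Y),$$ $$[\varphi X,\varphi Y]-\varphi[\varphi X,Y]-\varphi[X,\varphi Y]+\varphi^2[X,Y]=2\,d\eta(X,Y)\,\xi,$$ where $d\eta(X,Y)=\tfrac12\bigl(X\eta(Y)-Y\eta(X)-\eta([X,Y])\bigr)$. Let $\nabla$ be the Levi-Civita connection of $g$, $R(X,Y)Z=\nabla_X\nabla_YZ-\nabla_Y\nabla_XZ-\nabla_{[X,Y]}Z$ and $R(X,Y,Z,W)=g(R(X,Y)Z,W)$. A paraholomorphic section at $p\in M$ is a plane in $T_pM$ spanned by $\varphi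 v$ and $\varphi^2v$, where $v\in T_pM$ is such that $\varphi v$ is not isotropic; its sectional curvature $$\frac{R(\varphi v,\varphi^2v,\varphi^2v,\varphi v)}{g(\varphi v,\varphi v)\,g(\varphi^2v,\varphi^2v)}$$ is called a paraholomorphic sectional curvature at $p$. Write $\Phi(X,Y)=g(X,\varphi Y)$. (1) If, at a point $p$, the paraholomorphic sectional curvature does not depend on the paraholomorphic section, and $k$ is its value there, then for all $X,Y,Z,W\in T_pM$ $$\begin{aligned}R(X,Y,Z,W)={}&\tfrac{k-3}{4}\bigl(g(X,W)g(Z,Y)-g(Y,W)g(Z,X)\bigr)\\&+\tfrac{k+1}{4}\bigl(g(Z,X)\eta(Y)\eta(W)+g(W,Y)\eta(X)\eta(Z)-g(W,X)\eta(Y)\eta(Z)-g(Z,Y)\eta(W)\eta(X)\\&\qquad+\Phi(Z,Y)\Phi(X,W)-\Phi(Z,X)\Phi(Y,W)+2\Phi(X,Y)\Phi(Z,W)\bigr).\end{aligned}$$ (2) If at every point $p$ the paraholomorphic sectional curvature does not depend on the paraholomorphic section, with value $k(p)$, then the function $k$ is locally constant on $M$; in particular, $k$ is constant if $M$ is connected.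 The formula in (1) then holds at every point with this $k$. -/

import Mathlib

open Bundle VectorField
open scoped Manifold ContDiff Topology

noncomputable section

section PseudoRiemannian

variable {m : ℕ} {M : Type*} [TopologicalSpace M] [ChartedSpace (EuclideanSpace ℝ (Fin m)) M]
  [IsManifold (𝓡 m) ∞ M]

/-- A smooth pseudo-Riemannian metric (of arbitrary signature) on a smooth `m`-manifold. -/
structure PseudoRiemannianMetric (m : ℕ) (M : Type*) [TopologicalSpace M]
    [ChartedSpace (EuclideanSpace ℝ (Fin m)) M] [IsManifold (𝓡 m) ∞ M] where
  /-- The scalar product on each tangent space. -/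
  inner (p : M) : TangentSpace (𝓡 m) p →L[ℝ] TangentSpace (𝓡 m) p →L[ℝ] ℝ
  symm (p : M) (v w : TangentSpace (𝓡 m) p) : inner p v w = inner p w v
  nondegenerate (p : M) (v : TangentSpace (𝓡 m) p) (hv : ∀ w, inner p v w = 0) : v = 0
  contMDiff : ContMDiff (𝓡 m)
    ((𝓡 m).prod 𝓘(ℝ, EuclideanSpace ℝ (Fin m) →L[ℝ] EuclideanSpace ℝ (Fin m) →L[ℝ] ℝ)) ∞
    (fun p : M ↦ TotalSpace.mk'
      (EuclideanSpace ℝ (Fin m) →L[ℝ] EuclideanSpace ℝ (Fin m) →L[ℝ] ℝ)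
      (E := fun p : M ↦ TangentSpace (𝓡 m) p →L[ℝ] TangentSpace (𝓡 m) p →L[ℝ] ℝ) p (inner p))

namespace PseudoRiemannianMetric

variable (g : PseudoRiemannianMetric m M)

/-- The right-hand side of Koszul's formula for `g(∇_X Y, Z)` at the point `p`. -/
def koszul (X Y Z : Π q : M, TangentSpace (𝓡 m) q) (p : M) : ℝ :=
  (1 / 2) * (mvfderiv (𝓡 m) (fun q : M ↦ g.inner q (Y q) (Z q)) p (X p)
    + mvfderiv (𝓡 m) (fun q : M ↦ g.inner q (X q) (Z q)) p (Y p)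
    - mvfderiv (𝓡 m) (fun q : M ↦ g.inner q (X q) (Y q)) p (Z p)
    + g.inner p (mlieBracket (𝓡 m) X Y p) (Z p)
    - g.inner p (mlieBracket (𝓡 m) X Z p) (Y p)
    - g.inner p (mlieBracket (𝓡 m) Y Z p) (X p))

/-- The Levi-Civita connection `∇_X Y` of `g` at `p`: the unique tangent vector at `p` whose
products with the values at `p` of vector fields are given by Koszul's formula. It exists and is
unique when `X` and `Y` are differentiable at `p`
(see `inner_leviCivita` and `eq_leviCivita` below). -/
def leviCivita (X Y : Π q : M, TangentSpace (𝓡 m) q) (p : M) : TangentSpace (𝓡 m) p :=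
  Classical.epsilon fun w : TangentSpace (𝓡 m) p ↦
    ∀ Z : Π q : M, TangentSpace (𝓡 m) q, MDifferentiableAt (𝓡 m) (𝓡 m).tangent (T% Z) p →
      g.inner p w (Z p) = g.koszul X Y Z p

theorem mdifferentiableAt_inner {X Y : Π q : M, TangentSpace (𝓡 m) q} {p : M}
    (hX : MDifferentiableAt (𝓡 m) (𝓡 m).tangent (T% X) p) (hY : MDifferentiableAt (𝓡 m) (𝓡 m).tangent (T% Y) p) :
    MDifferentiableAt (𝓡 m) 𝓘(ℝ, ℝ) (fun q : M ↦ g.inner q (X q) (Y q)) p := by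
  have hg := (g.contMDiff p).mdifferentiableAt (by simp)
  have h : MDifferentiableAt (𝓡 m) ((𝓡 m).prod 𝓘(ℝ, ℝ)) (fun q : M ↦ TotalSpace.mk' ℝ (E := Bundle.Trivial M ℝ) q
      (g.inner q (X q) (Y q))) p :=
    MDifferentiableAt.clm_bundle_apply₂ (F₁ := EuclideanSpace ℝ (Fin m))
      (F₂ := EuclideanSpace ℝ (Fin m)) hg hX hY
  simp only [mdifferentiableAt_totalSpace] at h
  exact h.2

theorem koszul_tensorial {X Y : Π q : M, TangentSpace (𝓡 m) q} {p : M}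
    (hX : MDifferentiableAt (𝓡 m) (𝓡 m).tangent (T% X) p) (hY : MDifferentiableAt (𝓡 m) (𝓡 m).tangent (T% Y) p) :
    TensorialAt (𝓡 m) (EuclideanSpace ℝ (Fin m)) (fun Z ↦ g.koszul X Y Z p) p where
  smul {f Z} hf hZ := by
    have hYZ := g.mdifferentiableAt_inner hY hZ
    have hXZ := g.mdifferentiableAt_inner hX hZ
    simp only [koszul, mlieBracket_smul_right hf hZ, Pi.smul_apply', map_add, map_smul,
      smul_eq_mul, add_apply, smul_apply]
    rw [mvfderiv_fun_mul hf hYZ, mvfderiv_fun_mul hf hXZ]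
    simp only [add_apply, smul_apply, smul_eq_mul]
    rw [g.symm p (Z p) (Y p), g.symm p (Z p) (X p)]
    ring
  add {Z Z'} hZ hZ' := by
    simp only [koszul, mlieBracket_add_right hZ hZ', Pi.add_apply, map_add,
      add_apply]
    rw [mvfderiv_fun_add (g.mdifferentiableAt_inner hY hZ) (g.mdifferentiableAt_inner hY hZ'),
      mvfderiv_fun_add (g.mdifferentiableAt_inner hX hZ) (g.mdifferentiableAt_inner hX hZ')]
    simp only [add_apply]
    ring

theorem inner_leviCivita {X Y Z : Π q : M, TangentSpace (𝓡 m) q} {p : M}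
    (hX : MDifferentiableAt (𝓡 m) (𝓡 m).tangent (T% X) p) (hY : MDifferentiableAt (𝓡 m) (𝓡 m).tangent (T% Y) p) (hZ : MDifferentiableAt (𝓡 m) (𝓡 m).tangent (T% Z) p) :
    g.inner p (g.leviCivita X Y p) (Z p) = g.koszul X Y Z p := by
  have key : ∃ w : TangentSpace (𝓡 m) p, ∀ Z : Π q : M, TangentSpace (𝓡 m) q,
      MDifferentiableAt (𝓡 m) (𝓡 m).tangent (T% Z) p → g.inner p w (Z p) = g.koszul X Y Z p := by
    have hT := g.koszul_tensorial hX hY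
    have hfd : FiniteDimensional ℝ (TangentSpace (𝓡 m) p) :=
      inferInstanceAs (FiniteDimensional ℝ (EuclideanSpace ℝ (Fin m)))
    let B : TangentSpace (𝓡 m) p →ₗ[ℝ] Module.Dual ℝ (TangentSpace (𝓡 m) p) :=
      { toFun := fun v ↦ (g.inner p v : TangentSpace (𝓡 m) p →ₗ[ℝ] ℝ)
        map_add' := by intro v w; ext; simp
        map_smul' := by intro c v; ext; simp }
    have hB : Function.Injective B := by
      rw [← LinearMap.ker_eq_bot, LinearMap.ker_eq_bot']
      intro v hv
      exact g.nondegenerate p v fun w ↦ LinearMap.congr_fun hv w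
    have hs : Function.Surjective B :=
      (LinearMap.injective_iff_surjective_of_finrank_eq_finrank
        Subspace.dual_finrank_eq.symm).1 hB
    obtain ⟨w, hw⟩ := hs (TensorialAt.mkHom _ p hT : TangentSpace (𝓡 m) p →L[ℝ] ℝ)
    refine ⟨w, fun Z hZ ↦ ?_⟩
    have h1 := LinearMap.congr_fun hw (Z p)
    exact h1.trans (TensorialAt.mkHom_apply hT hZ)
  exact Classical.epsilon_spec key Z hZ

theorem eq_leviCivita {X Y : Π q : M, TangentSpace (𝓡 m) q} {p : M}
    (hX : MDifferentiableAt (𝓡 m) (𝓡 m).tangent (T% X) p) (hY : MDifferentiableAt (𝓡 m) (𝓡 m).tangent (T% Y) p) {w : TangentSpace (𝓡 m) p}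
    (hw : ∀ Z : Π q : M, TangentSpace (𝓡 m) q, MDifferentiableAt (𝓡 m) (𝓡 m).tangent (T% Z) p →
      g.inner p w (Z p) = g.koszul X Y Z p) :
    w = g.leviCivita X Y p := by
  refine sub_eq_zero.1 (g.nondegenerate p _ fun z ↦ ?_)
  have hz := FiberBundle.mdifferentiableAt_extend (𝓡 m) (EuclideanSpace ℝ (Fin m)) z
  have h1 := hw _ hz
  have h2 := g.inner_leviCivita hX hY hz
  rw [FiberBundle.extend_apply_self] at h1 h2
  simp [h1, h2]

/-- The Levi-Civita connection is torsion-free. -/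
theorem leviCivita_sub_swap {X Y : Π q : M, TangentSpace (𝓡 m) q} {p : M}
    (hX : MDifferentiableAt (𝓡 m) (𝓡 m).tangent (T% X) p) (hY : MDifferentiableAt (𝓡 m) (𝓡 m).tangent (T% Y) p) :
    g.leviCivita X Y p - g.leviCivita Y X p = mlieBracket (𝓡 m) X Y p := by
  refine sub_eq_zero.1 (g.nondegenerate p _ fun z ↦ ?_)
  have hz := FiberBundle.mdifferentiableAt_extend (𝓡 m) (EuclideanSpace ℝ (Fin m)) z
  have h1 := g.inner_leviCivita hX hY hz
  have h2 := g.inner_leviCivita hY hX hz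
  have h3 : (fun q : M ↦ g.inner q (Y q) (X q)) = fun q : M ↦ g.inner q (X q) (Y q) :=
    funext fun q ↦ g.symm q _ _
  rw [koszul, FiberBundle.extend_apply_self] at h1 h2
  rw [h3, mlieBracket_swap_apply (V := Y) (W := X)] at h2
  simp only [map_sub, map_neg, sub_apply, neg_apply]
    at h1 h2 ⊢
  rw [h1, h2]
  ring

/-- The Levi-Civita connection is compatible with the metric. -/
theorem mvfderiv_inner {X Y Z : Π q : M, TangentSpace (𝓡 m) q} {p : M}
    (hX : MDifferentiableAt (𝓡 m) (𝓡 m).tangent (T% X) p) (hY : MDifferentiableAt (𝓡 m) (𝓡 m).tangent (T% Y) p) (hZ : MDifferentiableAt (𝓡 m) (𝓡 m).tangent (T% Z) p) :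
    mvfderiv (𝓡 m) (fun q : M ↦ g.inner q (Y q) (Z q)) p (X p) =
      g.inner p (g.leviCivita X Y p) (Z p) + g.inner p (Y p) (g.leviCivita X Z p) := by
  rw [g.symm p (Y p), g.inner_leviCivita hX hY hZ, g.inner_leviCivita hX hZ hY, koszul, koszul,
    mlieBracket_swap_apply (V := Z) (W := Y)]
  have h3 : (fun q : M ↦ g.inner q (Z q) (Y q)) = fun q : M ↦ g.inner q (Y q) (Z q) :=
    funext fun q ↦ g.symm q _ _
  rw [h3]
  simp only [map_neg, neg_apply]
  ring

/-- The curvature operator `R(X, Y) Z = ∇_X ∇_Y Z - ∇_Y ∇_X Z - ∇_{[X, Y]} Z` on vector fields. -/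
def curvatureOperator (X Y Z : Π q : M, TangentSpace (𝓡 m) q) (p : M) : TangentSpace (𝓡 m) p :=
  g.leviCivita X (g.leviCivita Y Z) p - g.leviCivita Y (g.leviCivita X Z) p
    - g.leviCivita (mlieBracket (𝓡 m) X Y) Z p

/-- The curvature tensor `R(u, v, w, z) = g(R(u, v) w, z)` at `p`, computed by extending `u`, `v`,
`w` to vector fields that are smooth near `p`. -/
def curvature (p : M) (u v w z : TangentSpace (𝓡 m) p) : ℝ :=
  g.inner p (g.curvatureOperator (FiberBundle.extend (EuclideanSpace ℝ (Fin m)) u)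
    (FiberBundle.extend (EuclideanSpace ℝ (Fin m)) v)
    (FiberBundle.extend (EuclideanSpace ℝ (Fin m)) w) p) z

/-- The sectional curvature of the plane spanned by `u`, `v` (meaningful if the restriction of the
metric to that plane is nondegenerate). -/
def sectionalCurvature (p : M) (u v : TangentSpace (𝓡 m) p) : ℝ :=
  g.curvature p u v v u / (g.inner p u u * g.inner p v v - g.inner p u v ^ 2)

end PseudoRiemannianMetric

end PseudoRiemannian

/-- The exterior derivative of a one-form, with the normalization
`dη(X, Y) = (X η(Y) - Y η(X) - η([X, Y])) / 2`. -/
def halfExtDeriv {m : ℕ} {M : Type*} [TopologicalSpace M]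
    [ChartedSpace (EuclideanSpace ℝ (Fin m)) M]
    (η : Π p : M, TangentSpace (𝓡 m) p →L[ℝ] ℝ) (X Y : Π q : M, TangentSpace (𝓡 m) q) (p : M) :
    ℝ :=
  (1 / 2) * (mvfderiv (𝓡 m) (fun q : M ↦ η q (Y q)) p (X p) - mvfderiv (𝓡 m) (fun q : M ↦ η q (X q)) p (Y p)
    - η p (mlieBracket (𝓡 m) X Y p))

/-- The tensor `N_φ(X, Y) = [φX, φY] - φ[φX, Y] - φ[X, φY] + φ²[X, Y]`. -/
def nijenhuis {m : ℕ} {M : Type*} [TopologicalSpace M]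
    [ChartedSpace (EuclideanSpace ℝ (Fin m)) M]
    (φ : Π p : M, TangentSpace (𝓡 m) p →L[ℝ] TangentSpace (𝓡 m) p)
    (X Y : Π q : M, TangentSpace (𝓡 m) q) (p : M) : TangentSpace (𝓡 m) p :=
  mlieBracket (𝓡 m) (fun q ↦ φ q (X q)) (fun q ↦ φ q (Y q)) p
    - φ p (mlieBracket (𝓡 m) (fun q ↦ φ q (X q)) Y p)
    - φ p (mlieBracket (𝓡 m) X (fun q ↦ φ q (Y q)) p)
    + φ p (φ p (mlieBracket (𝓡 m) X Y p))

/-- A paracontact metric structure `(φ, ξ, η, g)` on a smooth manifold of dimension `2n+1`. -/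
structure ParacontactMetricStructure (n : ℕ) (M : Type*) [TopologicalSpace M]
    [ChartedSpace (EuclideanSpace ℝ (Fin (2 * n + 1))) M] [IsManifold (𝓡 (2 * n + 1)) ∞ M] where
  /-- The pseudo-Riemannian metric. -/
  g : PseudoRiemannianMetric (2 * n + 1) M
  /-- The tensor field of type `(1,1)`. -/
  φ (p : M) : TangentSpace (𝓡 (2 * n + 1)) p →L[ℝ] TangentSpace (𝓡 (2 * n + 1)) p
  /-- The vector field. -/
  ξ (p : M) : TangentSpace (𝓡 (2 * n + 1)) p
  /-- The one-form. -/
  η (p : M) : TangentSpace (𝓡 (2 * n + 1)) p →L[ℝ] ℝ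
  contMDiff_φ : ContMDiff (𝓡 (2 * n + 1))
    ((𝓡 (2 * n + 1)).prod 𝓘(ℝ, EuclideanSpace ℝ (Fin (2 * n + 1)) →L[ℝ]
      EuclideanSpace ℝ (Fin (2 * n + 1)))) ∞
    (fun p : M ↦ TotalSpace.mk'
      (EuclideanSpace ℝ (Fin (2 * n + 1)) →L[ℝ] EuclideanSpace ℝ (Fin (2 * n + 1)))
      (E := fun p : M ↦ TangentSpace (𝓡 (2 * n + 1)) p →L[ℝ] TangentSpace (𝓡 (2 * n + 1)) p)
      p (φ p))
  contMDiff_ξ : ContMDiff (𝓡 (2 * n + 1)) (𝓡 (2 * n + 1)).tangent ∞ (T% ξ)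
  contMDiff_η : ContMDiff (𝓡 (2 * n + 1))
    ((𝓡 (2 * n + 1)).prod 𝓘(ℝ, EuclideanSpace ℝ (Fin (2 * n + 1)) →L[ℝ] ℝ)) ∞
    (fun p : M ↦ TotalSpace.mk' (EuclideanSpace ℝ (Fin (2 * n + 1)) →L[ℝ] ℝ)
      (E := fun p : M ↦ TangentSpace (𝓡 (2 * n + 1)) p →L[ℝ] ℝ) p (η p))
  φ_ξ (p : M) : φ p (ξ p) = 0
  η_φ (p : M) (v : TangentSpace (𝓡 (2 * n + 1)) p) : η p (φ p v) = 0
  η_ξ (p : M) : η p (ξ p) = 1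
  φ_φ (p : M) (v : TangentSpace (𝓡 (2 * n + 1)) p) : φ p (φ p v) = v - η p v • ξ p
  inner_φ_φ (p : M) (v w : TangentSpace (𝓡 (2 * n + 1)) p) :
    g.inner p (φ p v) (φ p w) = -g.inner p v w + η p v * η p w
  inner_φ (p : M) (X Y : Π q : M, TangentSpace (𝓡 (2 * n + 1)) q)
    (hX : ContMDiffAt (𝓡 (2 * n + 1)) (𝓡 (2 * n + 1)).tangent ∞ (T% X) p) (hY : ContMDiffAt (𝓡 (2 * n + 1)) (𝓡 (2 * n + 1)).tangent ∞ (T% Y) p) :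
    g.inner p (X p) (φ p (Y p)) = halfExtDeriv η X Y p

namespace ParacontactMetricStructure

variable {n : ℕ} {M : Type*} [TopologicalSpace M]
  [ChartedSpace (EuclideanSpace ℝ (Fin (2 * n + 1))) M] [IsManifold (𝓡 (2 * n + 1)) ∞ M]

/-- A paracontact metric structure is paraSasakian if `N_φ(X, Y) = 2 dη(X, Y) ξ`. -/
def IsParaSasakian (S : ParacontactMetricStructure n M) : Prop :=
  ∀ (p : M) (X Y : Π q : M, TangentSpace (𝓡 (2 * n + 1)) q),
    ContMDiffAt (𝓡 (2 * n + 1)) (𝓡 (2 * n + 1)).tangent ∞ (T% X) p → ContMDiffAt (𝓡 (2 * n + 1)) (𝓡 (2 * n + 1)).tangent ∞ (T% Y) p →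
      nijenhuis S.φ X Y p = (2 * halfExtDeriv S.η X Y p) • S.ξ p

/-- The vector `v` at `p` determines a paraholomorphic section, namely the plane spanned by `φv`
and `φ²v`, if `φv` is not isotropic. -/
def DeterminesSection (S : ParacontactMetricStructure n M) (p : M)
    (v : TangentSpace (𝓡 (2 * n + 1)) p) : Prop :=
  S.g.inner p (S.φ p v) (S.φ p v) ≠ 0

/-- The paraholomorphic sectional curvature of the section spanned by `φv` and `φ²v`. -/
def paraholomorphicCurvature (S : ParacontactMetricStructure n M) (p : M)
    (v : TangentSpace (𝓡 (2 * n + 1)) p) : ℝ :=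
  S.g.sectionalCurvature p (S.φ p v) (S.φ p (S.φ p v))

/-- All paraholomorphic sections at `p` have the same sectional curvature. -/
def IndependentOfSection (S : ParacontactMetricStructure n M) (p : M) : Prop :=
  ∀ v w : TangentSpace (𝓡 (2 * n + 1)) p, S.DeterminesSection p v → S.DeterminesSection p w →
    S.paraholomorphicCurvature p v = S.paraholomorphicCurvature p w

/-- The two-tensor `φ_{ij} = g_{il} φ^l_j`, that is `(u, v) ↦ g(u, φ v)`. -/
def fundamentalForm (S : ParacontactMetricStructure n M) (p : M)
    (u v : TangentSpace (𝓡 (2 * n + 1)) p) : ℝ :=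
  S.g.inner p u (S.φ p v)

/-- The curvature tensor at `p` has the explicit form of constant paraholomorphic sectional
curvature `k`; the vectors `x`, `y`, `z`, `w` fill the indices `m`, `j`, `h`, `l`
of `R_{mjhl}`. -/
def HasCurvatureForm (S : ParacontactMetricStructure n M) (p : M) (k : ℝ) : Prop :=
  ∀ x y z w : TangentSpace (𝓡 (2 * n + 1)) p,
    S.g.curvature p x y z w =
      (k - 3) / 4 * (S.g.inner p x w * S.g.inner p z y - S.g.inner p y w * S.g.inner p z x)
      + (k + 1) / 4 *
        (S.g.inner p z x * S.η p y * S.η p w + S.g.inner p w y * S.η p x * S.η p z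
          - S.g.inner p w x * S.η p y * S.η p z - S.g.inner p z y * S.η p w * S.η p x
          + S.fundamentalForm p z y * S.fundamentalForm p x w
          - S.fundamentalForm p z x * S.fundamentalForm p y w
          + 2 * S.fundamentalForm p x y * S.fundamentalForm p z w)

end ParacontactMetricStructure

end

/-!
The theorem is the paraSasakian analogue of the theorem on Sasakian space forms.

Everything rests on the two formulas `∇_X ξ = -φX` and `(∇_X φ)Y = -g(X, Y)ξ + η(Y)X`, which follow
from normality of the structure, the identity `dη = Φ` and `dΦ = 0`
(`IsParacontact.covariantDerivative_identities` is the algebra, `IsParaSasakian.nabla_xi` and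
`IsParaSasakian.nabla_phi` are the results). Differentiating them once more gives the values of the
curvature tensor on `ξ` and its failure to commute with `φ`: `IsParaSasakian.curvature_xi` and
`IsParaSasakian.curvature_phi`.

The tensor on the right-hand side of the claim (`paraCurvatureForm`) has the symmetries of a
curvature tensor, the same values on `ξ`, the same commutator with `φ`, and paraholomorphic sectional
curvature `k`. So its difference with `R` is annihilated by `ξ`, commutes with `φ`, and has
vanishing paraholomorphic sectional curvature on the sections that are not isotropic, hence, by density,
on all of them. As in Kähler geometry, polarization shows that such a tensor is zero
(`IsParacontact.eq_zero_of_paraholomorphic`); this is the pointwise statement,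
`IsParaSasakian.hasCurvatureForm`.

For the global statement, `k` is smooth because it is the curvature of the sections determined by a
smooth vector field. Substituting the explicit form of `R` into the second Bianchi identity, the terms
coming from `∇η` and `∇φ` cancel (`IsParacontact.formDeriv_cyclic_sum`), and what remains is that the
cyclic sum of `dk ⊗ T` vanishes, where `T` is the coefficient of `k` in the explicit form. Evaluating it
on a vector `u` and a nondegenerate paraholomorphic section orthogonal to it gives `dk(u) = 0`
(`IsParacontact.eq_zero_of_cyclic_sum`). For a horizontal `u` that is not isotropic such a section exists
since the dimension is at least five; the isotropic ones follow by continuity, and `ξ` is orthogonal to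
every section. So `dk = 0`, and `k` is locally constant.

Curvature identities at a point are derived from extensions of tangent vectors with constant
coordinates in a chart (`coordField`): these fields commute, so that `R(X, Y) = [∇_X, ∇_Y]` and
`∇_X Y = ∇_Y X` near the point.
-/

noncomputable section

/-! ### Smooth vector fields and Lie brackets -/

section Calculus
open Filter

variable {m : ℕ} {M : Type*} [TopologicalSpace M] [ChartedSpace (EuclideanSpace ℝ (Fin m)) M]
  [IsManifold (𝓡 m) ∞ M]

omit [IsManifold (𝓡 m) ∞ M] in
theorem mvfderiv_congr_of_eventuallyEq {f f' : M → ℝ} {p : M} (h : f =ᶠ[𝓝 p] f') :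
    mvfderiv (𝓡 m) f p = mvfderiv (𝓡 m) f' p := by
  ext v
  simp only [mvfderiv, h.mfderiv_eq]
  rfl

theorem two_le_infty : (2 : WithTop ℕ∞) ≤ ∞ := WithTop.coe_le_coe.2 le_top

theorem three_le_infty : (3 : WithTop ℕ∞) ≤ ∞ := WithTop.coe_le_coe.2 le_top

variable (m M) in
theorem isManifold_minSmoothness_two : IsManifold (𝓡 m) (minSmoothness ℝ 2) M :=
  IsManifold.of_le (n := ∞) (by simpa using two_le_infty)

variable (m M) in
theorem isManifold_minSmoothness_three : IsManifold (𝓡 m) (minSmoothness ℝ 3) M :=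
  IsManifold.of_le (n := ∞) (by simpa using three_le_infty)

theorem ContMDiffAt.mlieBracket_infty {X Y : Π q : M, TangentSpace (𝓡 m) q} {p : M}
    (hX : ContMDiffAt (𝓡 m) (𝓡 m).tangent ∞ (T% X) p) (hY : ContMDiffAt (𝓡 m) (𝓡 m).tangent ∞ (T% Y) p) :
    ContMDiffAt (𝓡 m) (𝓡 m).tangent ∞ (T% (mlieBracket (𝓡 m) X Y)) p := by
  have : IsManifold (𝓡 m) (((⊤ : ℕ∞) : WithTop ℕ∞) + 1) M := by simpa
  have := isManifold_minSmoothness_two m M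
  exact ContMDiffAt.mlieBracket_vectorField (m := ⊤) (n := ⊤) hX hY (by simp)

theorem contMDiffAt_mvfderiv_apply {X : Π q : M, TangentSpace (𝓡 m) q} {f : M → ℝ} {p : M}
    (hX : ContMDiffAt (𝓡 m) (𝓡 m).tangent ∞ (T% X) p) (hf : ContMDiffAt (𝓡 m) 𝓘(ℝ, ℝ) ∞ f p) :
    ContMDiffAt (𝓡 m) 𝓘(ℝ, ℝ) ∞ (fun q ↦ mvfderiv (𝓡 m) f q (X q)) p := by
  have h1 := hf.mfderiv_const (m := ∞) (by simp)
  have h2 : ContMDiffAt (𝓡 m) (𝓘(ℝ, ℝ).tangent) ∞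
      (fun q ↦ (⟨f q, mfderiv (𝓡 m) 𝓘(ℝ, ℝ) f q (X q)⟩ : TangentBundle 𝓘(ℝ, ℝ) ℝ)) p :=
    ContMDiffAt.clm_apply_of_inCoordinates h1 hX hf
  exact (contMDiff_snd_tangentBundle_modelSpace ℝ 𝓘(ℝ, ℝ)).contMDiffAt.comp p h2

theorem ContMDiffAt.mdiff_infty {X : Π q : M, TangentSpace (𝓡 m) q} {p : M}
    (hX : ContMDiffAt (𝓡 m) (𝓡 m).tangent ∞ (T% X) p) :
    MDifferentiableAt (𝓡 m) (𝓡 m).tangent (T% X) p :=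
  hX.mdifferentiableAt (by simp)

/-- A vector field which is smooth at `p` is differentiable near `p`. -/
theorem ContMDiffAt.eventually_mdiff {X : Π q : M, TangentSpace (𝓡 m) q} {p : M}
    (hX : ContMDiffAt (𝓡 m) (𝓡 m).tangent ∞ (T% X) p) :
    ∀ᶠ q in 𝓝 p, MDifferentiableAt (𝓡 m) (𝓡 m).tangent (T% X) q := by
  have h := (contMDiffAt_iff_contMDiffAt_nhds (by simp)).1 (hX.of_le (m := 1) (by simp))
  exact h.mono fun q hq ↦ hq.mdifferentiableAt (by simp)

theorem ContMDiffAt.eventually_mdiff_fun {f : M → ℝ} {p : M}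
    (hf : ContMDiffAt (𝓡 m) 𝓘(ℝ, ℝ) ∞ f p) :
    ∀ᶠ q in 𝓝 p, MDifferentiableAt (𝓡 m) 𝓘(ℝ, ℝ) f q := by
  have h := (contMDiffAt_iff_contMDiffAt_nhds (by simp)).1 (hf.of_le (m := 1) (by simp))
  exact h.mono fun q hq ↦ hq.mdifferentiableAt (by simp)

/-- The extension of a tangent vector to the vector field with constant coordinates in the preferred
chart at its base point. -/
abbrev coordField {p : M} (v : TangentSpace (𝓡 m) p) : Π q : M, TangentSpace (𝓡 m) q :=
  FiberBundle.extend (EuclideanSpace ℝ (Fin m)) v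

theorem contMDiffAt_coordField {p : M} (v : TangentSpace (𝓡 m) p) :
    ContMDiffAt (𝓡 m) (𝓡 m).tangent ∞ (T% (coordField v)) p :=
  FiberBundle.contMDiffAt_extend _ _ v

theorem coordField_self {p : M} (v : TangentSpace (𝓡 m) p) : coordField v p = v :=
  FiberBundle.extend_apply_self _ _

theorem eventually_contMDiffAt_coordField {p : M} (v : TangentSpace (𝓡 m) p) :
    ∀ᶠ q in 𝓝 p, ContMDiffAt (𝓡 m) (𝓡 m).tangent ∞ (T% (coordField v)) q := by
  obtain ⟨s, hs, h⟩ := FiberBundle.exists_contMDiffOn_extend (k := ∞) (𝓡 m) (EuclideanSpace ℝ (Fin m)) v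
  filter_upwards [eventually_eventually_nhds.2 hs] with q hq
  exact h.contMDiffAt hq

/-- The Lie bracket acts on smooth functions as a commutator. -/
theorem mvfderiv_mlieBracket {U V : Π q : M, TangentSpace (𝓡 m) q} {f : M → ℝ} {p : M}
    (hU : ContMDiffAt (𝓡 m) (𝓡 m).tangent ∞ (T% U) p) (hV : ContMDiffAt (𝓡 m) (𝓡 m).tangent ∞ (T% V) p)
    (hf : ContMDiffAt (𝓡 m) 𝓘(ℝ, ℝ) ∞ f p) :
    mvfderiv (𝓡 m) f p (mlieBracket (𝓡 m) U V p) =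
      mvfderiv (𝓡 m) (fun q ↦ mvfderiv (𝓡 m) f q (V q)) p (U p)
        - mvfderiv (𝓡 m) (fun q ↦ mvfderiv (𝓡 m) f q (U q)) p (V p) := by
  -- compare the Jacobi identities for `W` and `fW`, where `W` does not vanish at `p`
  rcases subsingleton_or_nontrivial (TangentSpace (𝓡 m) p) with hs | hs
  · simp [Subsingleton.elim (mlieBracket (𝓡 m) U V p) 0, Subsingleton.elim (U p) 0,
      Subsingleton.elim (V p) 0]
  obtain ⟨w, hw⟩ := exists_ne (0 : TangentSpace (𝓡 m) p)
  set W := coordField w with hWdef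
  have hWp : W p = w := FiberBundle.extend_apply_self _ _
  have hW : ContMDiffAt (𝓡 m) (𝓡 m).tangent ∞ (T% W) p := FiberBundle.contMDiffAt_extend _ _ w
  have hfW : ContMDiffAt (𝓡 m) (𝓡 m).tangent ∞ (T% (f • W)) p := hf.smul_section hW
  have := isManifold_minSmoothness_two m M
  have := isManifold_minSmoothness_three m M
  have two : minSmoothness ℝ 2 ≤ ∞ := by simpa using two_le_infty
  have J := leibniz_identity_mlieBracket_apply (hU.of_le two) (hV.of_le two) (hfW.of_le two)
  have J0 := leibniz_identity_mlieBracket_apply (hU.of_le two) (hV.of_le two) (hW.of_le two)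
  have e : ∀ {Z : Π q : M, TangentSpace (𝓡 m) q}, mlieBracket (𝓡 m) Z (f • W) =ᶠ[𝓝 p]
      (fun q ↦ mvfderiv (𝓡 m) f q (Z q)) • W + f • mlieBracket (𝓡 m) Z W := by
    intro Z
    filter_upwards [hf.eventually_mdiff_fun, hW.eventually_mdiff] with q h1 h2
    rw [mlieBracket_smul_right h1 h2]; rfl
  have expand : ∀ {Y Z : Π q : M, TangentSpace (𝓡 m) q},
      ContMDiffAt (𝓡 m) (𝓡 m).tangent ∞ (T% Z) p → 
      mlieBracket (𝓡 m) Y (mlieBracket (𝓡 m) Z (f • W)) p =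
      mvfderiv (𝓡 m) (fun q ↦ mvfderiv (𝓡 m) f q (Z q)) p (Y p) • W p
      + mvfderiv (𝓡 m) f p (Z p) • mlieBracket (𝓡 m) Y W p
      + (mvfderiv (𝓡 m) f p (Y p) • mlieBracket (𝓡 m) Z W p
      + f p • mlieBracket (𝓡 m) Y (mlieBracket (𝓡 m) Z W) p) := by
    intro Y Z hZ
    have h1 := contMDiffAt_mvfderiv_apply hZ hf
    have h2 := hZ.mlieBracket_infty hW
    rw [(EventuallyEq.rfl (f := Y)).mlieBracket_vectorField_eq e, mlieBracket_add_right
      (h1.smul_section hW).mdiff_infty (hf.smul_section h2).mdiff_infty,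
      mlieBracket_smul_right (h1.mdifferentiableAt (by simp)) hW.mdiff_infty,
      mlieBracket_smul_right (hf.mdifferentiableAt (by simp)) h2.mdiff_infty]
  rw [expand hV, expand hU, mlieBracket_smul_right (hf.mdifferentiableAt (by simp)) hW.mdiff_infty, J0] at J
  have key : (mvfderiv (𝓡 m) f p (mlieBracket (𝓡 m) U V p) -
      (mvfderiv (𝓡 m) (fun q ↦ mvfderiv (𝓡 m) f q (V q)) p (U p)
        - mvfderiv (𝓡 m) (fun q ↦ mvfderiv (𝓡 m) f q (U q)) p (V p))) • w = 0 := by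
    rw [hWp] at J
    rw [← sub_eq_zero] at J
    rw [← neg_eq_zero, ← J]
    module
  rcases smul_eq_zero.1 key with h | h
  · linarith
  · exact absurd h hw

/-- A constant vector field on a Euclidean space. -/
def constField (m : ℕ) (c : EuclideanSpace ℝ (Fin m)) (y : EuclideanSpace ℝ (Fin m)) : TangentSpace (𝓡 m) y := c

theorem contMDiffAt_constField (c : EuclideanSpace ℝ (Fin m)) (y : EuclideanSpace ℝ (Fin m)) :
    ContMDiffAt (𝓡 m) (𝓡 m).tangent ∞ (T% (constField m c)) y :=
  contMDiffAt_vectorSpace_iff_contDiffAt.2 contDiffAt_const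

theorem mlieBracket_constField (c d : EuclideanSpace ℝ (Fin m)) :
    mlieBracket (𝓡 m) (constField m c) (constField m d) = 0 := by
  have h : lieBracket ℝ (fun _ : EuclideanSpace ℝ (Fin m) ↦ c) (fun _ ↦ d) = 0 := by
    ext1 y
    simp [lieBracket_eq]
  rw [← lieBracketWithin_univ] at h
  rw [← mlieBracketWithin_univ, mlieBracketWithin_eq_lieBracketWithin]
  exact h

/-- In the preferred chart at its base point, `coordField v` is the pullback of a constant field. -/
theorem coordField_eq_mpullback {p : M} (v : TangentSpace (𝓡 m) p) : ∃ c : EuclideanSpace ℝ (Fin m),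
    ∀ q ∈ (extChartAt (𝓡 m) p).source,
      coordField v q = mpullback (𝓡 m) (𝓡 m) (extChartAt (𝓡 m) p) (constField m c) q := by
  refine ⟨(trivializationAt (EuclideanSpace ℝ (Fin m)) (TangentSpace (𝓡 m)) p ⟨p, v⟩).2, fun q hq ↦ ?_⟩
  have hq' : q ∈ (chartAt (EuclideanSpace ℝ (Fin m)) p).source := by simpa using hq
  have hinv := isInvertible_mfderiv_extChartAt (I := 𝓡 m) hq
  have e := TangentBundle.continuousLinearMapAt_trivializationAt (I := 𝓡 m) hq'
  rw [mpullback_apply, ← e, constField, coordField, FiberBundle.extend]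
  rw [← e] at hinv
  obtain ⟨L, hL⟩ := hinv
  rw [← hL, ContinuousLinearMap.inverse_equiv]
  refine ((ContinuousLinearEquiv.symm_apply_eq L).2 ?_).symm
  rw [← ContinuousLinearEquiv.coe_coe, hL]
  have hb : q ∈ (trivializationAt (EuclideanSpace ℝ (Fin m)) (TangentSpace (𝓡 m)) p).baseSet := by
    simpa using hq'
  have h := Trivialization.continuousLinearMapAt_symmL (R := ℝ)
    (trivializationAt (EuclideanSpace ℝ (Fin m)) (TangentSpace (𝓡 m)) p) hb
    (trivializationAt (EuclideanSpace ℝ (Fin m)) (TangentSpace (𝓡 m)) p ⟨p, v⟩).2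
  have h' := Trivialization.symmL_apply (R := ℝ)
    (trivializationAt (EuclideanSpace ℝ (Fin m)) (TangentSpace (𝓡 m)) p) hb
    (trivializationAt (EuclideanSpace ℝ (Fin m)) (TangentSpace (𝓡 m)) p ⟨p, v⟩).2
  exact h.symm.trans (congrArg _ h')

/-- Vector fields with constant coordinates in a chart commute. -/
theorem mlieBracket_coordField {p : M} (v w : TangentSpace (𝓡 m) p) :
    ∀ᶠ q in 𝓝 p, mlieBracket (𝓡 m) (coordField v) (coordField w) q = 0 := by
  have := isManifold_minSmoothness_two m M
  have := isManifold_minSmoothness_three m M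
  have hsrc : ∀ᶠ q in 𝓝 p, q ∈ (extChartAt (𝓡 m) p).source := extChartAt_source_mem_nhds p
  obtain ⟨a, ha⟩ := coordField_eq_mpullback v
  obtain ⟨b, hb⟩ := coordField_eq_mpullback w
  filter_upwards [eventually_eventually_nhds.2 hsrc] with q hq
  have e1 : coordField v =ᶠ[𝓝 q] mpullback (𝓡 m) (𝓡 m) (extChartAt (𝓡 m) p) (constField m a) := hq.mono ha
  have e2 : coordField w =ᶠ[𝓝 q] mpullback (𝓡 m) (𝓡 m) (extChartAt (𝓡 m) p) (constField m b) := hq.mono hb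
  rw [e1.mlieBracket_vectorField_eq e2, ← mpullback_mlieBracket (n := ∞)
    (contMDiffAt_constField _ _).mdiff_infty (contMDiffAt_constField _ _).mdiff_infty,
    mlieBracket_constField, mpullback_zero]
  · rfl
  · exact contMDiffAt_extChartAt' (by simpa using hq.self_of_nhds)
  · simpa using two_le_infty

end Calculus

/-! ### The Levi-Civita connection -/

section LeviCivita
open Filter

variable {m : ℕ} {M : Type*} [TopologicalSpace M] [ChartedSpace (EuclideanSpace ℝ (Fin m)) M]
  [IsManifold (𝓡 m) ∞ M] (g : PseudoRiemannianMetric m M)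

namespace PseudoRiemannianMetric

theorem eq_of_inner_eq {p : M} {u v : TangentSpace (𝓡 m) p}
    (h : ∀ w, g.inner p u w = g.inner p v w) : u = v := by
  have h0 : u - v = 0 := g.nondegenerate p _ fun w ↦ by rw [map_sub, sub_apply, h, sub_self]
  exact sub_eq_zero.1 h0

theorem koszul_congr {X X' Y Y' : Π q : M, TangentSpace (𝓡 m) q} {p : M} (hX : X =ᶠ[𝓝 p] X')
    (hY : Y =ᶠ[𝓝 p] Y') (Z : Π q : M, TangentSpace (𝓡 m) q) :
    g.koszul X Y Z p = g.koszul X' Y' Z p := by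
  have h1 : (fun q : M ↦ g.inner q (Y q) (Z q)) =ᶠ[𝓝 p] fun q ↦ g.inner q (Y' q) (Z q) :=
    hY.mono fun q h ↦ by simp only [h]
  have h2 : (fun q : M ↦ g.inner q (X q) (Z q)) =ᶠ[𝓝 p] fun q ↦ g.inner q (X' q) (Z q) :=
    hX.mono fun q h ↦ by simp only [h]
  have h3 : (fun q : M ↦ g.inner q (X q) (Y q)) =ᶠ[𝓝 p] fun q ↦ g.inner q (X' q) (Y' q) := by
    filter_upwards [hX, hY] with q h h'
    rw [h, h']
  rw [koszul, koszul, mvfderiv_congr_of_eventuallyEq h1, mvfderiv_congr_of_eventuallyEq h2,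
    mvfderiv_congr_of_eventuallyEq h3, hX.mlieBracket_vectorField_eq hY,
    hX.mlieBracket_vectorField_eq (EventuallyEq.rfl (f := Z)),
    hY.mlieBracket_vectorField_eq (EventuallyEq.rfl (f := Z)), hX.self_of_nhds, hY.self_of_nhds]

theorem leviCivita_congr {X X' Y Y' : Π q : M, TangentSpace (𝓡 m) q} {p : M} (hX : X =ᶠ[𝓝 p] X')
    (hY : Y =ᶠ[𝓝 p] Y') : g.leviCivita X Y p = g.leviCivita X' Y' p := by
  simp only [leviCivita, g.koszul_congr hX hY]

theorem leviCivita_eventuallyEq {X X' Y Y' : Π q : M, TangentSpace (𝓡 m) q} {p : M}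
    (hX : X =ᶠ[𝓝 p] X') (hY : Y =ᶠ[𝓝 p] Y') : g.leviCivita X Y =ᶠ[𝓝 p] g.leviCivita X' Y' := by
  filter_upwards [eventually_eventually_nhds.2 hX, eventually_eventually_nhds.2 hY] with q h h'
  exact g.leviCivita_congr h h'

section Linearity

variable {X X' Y Y' : Π q : M, TangentSpace (𝓡 m) q} {f : M → ℝ} {p : M}

theorem leviCivita_add_right
    (hX : MDifferentiableAt (𝓡 m) (𝓡 m).tangent (T% X) p)
    (hY : MDifferentiableAt (𝓡 m) (𝓡 m).tangent (T% Y) p)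
    (hY' : MDifferentiableAt (𝓡 m) (𝓡 m).tangent (T% Y') p) :
    g.leviCivita X (Y + Y') p = g.leviCivita X Y p + g.leviCivita X Y' p := by
  refine (g.eq_leviCivita hX (mdifferentiableAt_add_section hY hY') fun Z hZ ↦ ?_).symm
  rw [map_add, add_apply, g.inner_leviCivita hX hY hZ, g.inner_leviCivita hX hY' hZ]
  simp only [koszul, mlieBracket_add_right hY hY', mlieBracket_add_left hY hY', Pi.add_apply, map_add, add_apply]
  rw [mvfderiv_fun_add (g.mdifferentiableAt_inner hY hZ) (g.mdifferentiableAt_inner hY' hZ),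
    mvfderiv_fun_add (g.mdifferentiableAt_inner hX hY) (g.mdifferentiableAt_inner hX hY')]
  simp only [add_apply]
  ring

theorem leviCivita_smul_right
    (hf : MDifferentiableAt (𝓡 m) 𝓘(ℝ, ℝ) f p)
    (hX : MDifferentiableAt (𝓡 m) (𝓡 m).tangent (T% X) p)
    (hY : MDifferentiableAt (𝓡 m) (𝓡 m).tangent (T% Y) p) :
    g.leviCivita X (f • Y) p = mvfderiv (𝓡 m) f p (X p) • Y p + f p • g.leviCivita X Y p := by
  refine (g.eq_leviCivita hX (hf.smul_section hY) fun Z hZ ↦ ?_).symm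
  rw [map_add, add_apply, map_smul, map_smul, smul_apply, smul_apply, g.inner_leviCivita hX hY hZ]
  simp only [koszul, mlieBracket_smul_right hf hY, mlieBracket_smul_left hf hY, Pi.smul_apply', map_add, map_smul,
      smul_eq_mul, add_apply, smul_apply]
  rw [mvfderiv_fun_mul hf (g.mdifferentiableAt_inner hY hZ), mvfderiv_fun_mul hf (g.mdifferentiableAt_inner hX hY)]
  simp only [add_apply, smul_apply, smul_eq_mul]
  rw [g.symm p (Y p) (Z p), g.symm p (Y p) (X p)]
  ring

theorem leviCivita_add_left
    (hX : MDifferentiableAt (𝓡 m) (𝓡 m).tangent (T% X) p)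
    (hX' : MDifferentiableAt (𝓡 m) (𝓡 m).tangent (T% X') p)
    (hY : MDifferentiableAt (𝓡 m) (𝓡 m).tangent (T% Y) p) :
    g.leviCivita (X + X') Y p = g.leviCivita X Y p + g.leviCivita X' Y p := by
  refine (g.eq_leviCivita (mdifferentiableAt_add_section hX hX') hY fun Z hZ ↦ ?_).symm
  rw [map_add, add_apply, g.inner_leviCivita hX hY hZ, g.inner_leviCivita hX' hY hZ]
  simp only [koszul, mlieBracket_add_left hX hX', Pi.add_apply, map_add, add_apply]
  rw [mvfderiv_fun_add (g.mdifferentiableAt_inner hX hZ) (g.mdifferentiableAt_inner hX' hZ),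
    mvfderiv_fun_add (g.mdifferentiableAt_inner hX hY) (g.mdifferentiableAt_inner hX' hY)]
  simp only [add_apply]
  ring

theorem leviCivita_smul_left
    (hf : MDifferentiableAt (𝓡 m) 𝓘(ℝ, ℝ) f p)
    (hX : MDifferentiableAt (𝓡 m) (𝓡 m).tangent (T% X) p)
    (hY : MDifferentiableAt (𝓡 m) (𝓡 m).tangent (T% Y) p) :
    g.leviCivita (f • X) Y p = f p • g.leviCivita X Y p := by
  refine (g.eq_leviCivita (hf.smul_section hX) hY fun Z hZ ↦ ?_).symm
  rw [map_smul, smul_apply, g.inner_leviCivita hX hY hZ]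
  simp only [koszul, mlieBracket_smul_left hf hX, Pi.smul_apply', map_add, map_smul,
      smul_eq_mul, add_apply, smul_apply]
  rw [mvfderiv_fun_mul hf (g.mdifferentiableAt_inner hX hZ), mvfderiv_fun_mul hf (g.mdifferentiableAt_inner hX hY)]
  simp only [add_apply, smul_apply, smul_eq_mul]
  rw [g.symm p (X p) (Z p)]
  ring

/-- `∇_X Y` at `p` depends on `X` only through its value at `p`. -/
theorem leviCivita_congr_left
    (hX : MDifferentiableAt (𝓡 m) (𝓡 m).tangent (T% X) p)
    (hX' : MDifferentiableAt (𝓡 m) (𝓡 m).tangent (T% X') p)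
    (hY : MDifferentiableAt (𝓡 m) (𝓡 m).tangent (T% Y) p) (h : X p = X' p) :
    g.leviCivita X Y p = g.leviCivita X' Y p := by
  have hT : TensorialAt (𝓡 m) (EuclideanSpace ℝ (Fin m)) (fun X ↦ g.leviCivita X Y p) p :=
    ⟨fun hf hZ ↦ g.leviCivita_smul_left hf hZ hY, fun hZ hZ' ↦ g.leviCivita_add_left hZ hZ' hY⟩
  exact hT.pointwise hX hX' h

end Linearity

section Smoothness

variable {X Y Z : Π q : M, TangentSpace (𝓡 m) q} {f : M → ℝ} {p : M}

theorem contMDiffAt_inner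
    (hX : ContMDiffAt (𝓡 m) (𝓡 m).tangent ∞ (T% X) p)
    (hY : ContMDiffAt (𝓡 m) (𝓡 m).tangent ∞ (T% Y) p) :
    ContMDiffAt (𝓡 m) 𝓘(ℝ, ℝ) ∞ (fun q : M ↦ g.inner q (X q) (Y q)) p := by
  have h : ContMDiffAt (𝓡 m) ((𝓡 m).prod 𝓘(ℝ, ℝ)) ∞ (fun q : M ↦ TotalSpace.mk' ℝ (E := Bundle.Trivial M ℝ) q
      (g.inner q (X q) (Y q))) p :=
    ContMDiffAt.clm_bundle_apply₂ (F₁ := EuclideanSpace ℝ (Fin m))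
      (F₂ := EuclideanSpace ℝ (Fin m)) (g.contMDiff p) hX hY
  simp only [contMDiffAt_totalSpace] at h
  exact h.2

theorem contMDiffAt_koszul
    (hX : ContMDiffAt (𝓡 m) (𝓡 m).tangent ∞ (T% X) p)
    (hY : ContMDiffAt (𝓡 m) (𝓡 m).tangent ∞ (T% Y) p)
    (hZ : ContMDiffAt (𝓡 m) (𝓡 m).tangent ∞ (T% Z) p) :
    ContMDiffAt (𝓡 m) 𝓘(ℝ, ℝ) ∞ (g.koszul X Y Z) p := by
  have h1 := contMDiffAt_mvfderiv_apply hX (g.contMDiffAt_inner hY hZ)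
  have h2 := contMDiffAt_mvfderiv_apply hY (g.contMDiffAt_inner hX hZ)
  have h3 := contMDiffAt_mvfderiv_apply hZ (g.contMDiffAt_inner hX hY)
  have h4 := g.contMDiffAt_inner (hX.mlieBracket_infty hY) hZ
  have h5 := g.contMDiffAt_inner (hX.mlieBracket_infty hZ) hY
  have h6 := g.contMDiffAt_inner (hY.mlieBracket_infty hZ) hX
  exact contMDiffAt_const.mul (((((h1.add h2).sub h3).add h4).sub h5).sub h6)

/-- The Levi-Civita connection takes smooth vector fields to smooth vector fields: its components
in a local frame solve a linear system whose matrix is the Gram matrix of the frame. -/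
theorem contMDiffAt_leviCivita
    (hX : ContMDiffAt (𝓡 m) (𝓡 m).tangent ∞ (T% X) p)
    (hY : ContMDiffAt (𝓡 m) (𝓡 m).tangent ∞ (T% Y) p) :
    ContMDiffAt (𝓡 m) (𝓡 m).tangent ∞ (T% (g.leviCivita X Y)) p := by
  let e := trivializationAt (EuclideanSpace ℝ (Fin m)) (TangentSpace (𝓡 m)) p
  have hp : p ∈ e.baseSet := FiberBundle.mem_baseSet_trivializationAt' p
  let b := (EuclideanSpace.basisFun (Fin m) ℝ).toBasis
  let E := e.localFrame b
  have hE : ∀ i, ∀ q ∈ e.baseSet, ContMDiffAt (𝓡 m) (𝓡 m).tangent ∞ (T% (E i)) q := fun i q hq ↦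
    contMDiffAt_localFrame_of_mem ∞ e b i hq
  have hF := e.isLocalFrameOn_localFrame_baseSet (𝓡 m) ∞ b
  let G : M → Matrix (Fin m) (Fin m) ℝ := fun q ↦ .of fun i j ↦ g.inner q (E i q) (E j q)
  let w : M → Fin m → ℝ := fun q i ↦ g.koszul X Y (E i) q
  have hG : ∀ i j, ContMDiffAt (𝓡 m) 𝓘(ℝ, ℝ) ∞ (fun q ↦ G q i j) p := fun i j ↦
    g.contMDiffAt_inner (hE i p hp) (hE j p hp)
  have hdet : ∀ A : M → Matrix (Fin m) (Fin m) ℝ,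
      (∀ i j, ContMDiffAt (𝓡 m) 𝓘(ℝ, ℝ) ∞ (fun q ↦ A q i j) p) →
      ContMDiffAt (𝓡 m) 𝓘(ℝ, ℝ) ∞ (fun q ↦ (A q).det) p := by
    intro A hA
    simp only [Matrix.det_apply']
    exact contMDiffAt_finsetSum fun σ _ ↦ contMDiffAt_const.mul (contMDiffAt_finsetProd fun i _ ↦ hA _ _)
  have hext : ∀ q ∈ e.baseSet, ∀ u u' : TangentSpace (𝓡 m) q,
      (∀ i, g.inner q u (E i q) = g.inner q u' (E i q)) → u = u' := by
    intro q hq u u' hu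
    refine g.eq_of_inner_eq fun v ↦ ?_
    rw [← (hF.toBasisAt hq).sum_repr v, map_sum, map_sum]
    refine Finset.sum_congr rfl fun i _ ↦ ?_
    rw [map_smul, map_smul, IsLocalFrameOn.toBasisAt_coe, hu i]
  have hGunit : ∀ q ∈ e.baseSet, IsUnit (G q).det := by
    intro q hq
    rw [isUnit_iff_ne_zero]
    intro h0
    obtain ⟨c, hc, hc0⟩ := Matrix.exists_mulVec_eq_zero_iff.2 h0
    have hsum : ∑ i, c i • E i q = 0 := by
      refine hext q hq _ _ fun i ↦ ?_
      rw [g.symm, map_sum, map_zero, zero_apply]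
      have := congrFun hc0 i
      simpa [Matrix.mulVec, dotProduct, G, mul_comm] using this
    exact hc (funext (Fintype.linearIndependent_iff.1 (hF.linearIndependent hq) c hsum))
  have hco : (g.leviCivita X Y) =ᶠ[𝓝 p] fun q ↦ ∑ i, ((G q)⁻¹.mulVec (w q)) i • E i q := by
    filter_upwards [e.open_baseSet.mem_nhds hp, hX.eventually_mdiff, hY.eventually_mdiff] with q hq h1 h2
    refine hext q hq _ _ fun j ↦ ?_
    have hm : (G q).mulVec ((G q)⁻¹.mulVec (w q)) j = w q j := by
      rw [Matrix.mulVec_mulVec, Matrix.mul_nonsing_inv _ (hGunit q hq), Matrix.one_mulVec]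
    have hj : g.inner q (∑ i, ((G q)⁻¹.mulVec (w q)) i • E i q) (E j q) = w q j := by
      rw [← hm, g.symm, map_sum]
      simp only [map_smul, smul_eq_mul]
      rw [Matrix.mulVec, dotProduct]
      exact Finset.sum_congr rfl fun i _ ↦ mul_comm _ _
    exact (g.inner_leviCivita h1 h2 (hE j q hq).mdiff_infty).trans hj.symm
  have hs : ContMDiffAt (𝓡 m) (𝓡 m).tangent ∞ (T% (fun q ↦ ∑ i, ((G q)⁻¹.mulVec (w q)) i • E i q)) p := by
    refine ContMDiffAt.sum_section fun i _ ↦ ContMDiffAt.smul_section ?_ (hE i p hp)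
    simp only [Matrix.mulVec, dotProduct]
    refine contMDiffAt_finsetSum fun j _ ↦ ContMDiffAt.mul ?_ (g.contMDiffAt_koszul hX hY (hE j p hp))
    simp only [Matrix.inv_def, Ring.inverse_eq_inv', Matrix.smul_apply, smul_eq_mul, Matrix.adjugate_apply]
    refine ContMDiffAt.mul ((hdet G hG).inv₀ (hGunit p hp).ne_zero) (hdet _ fun k l ↦ ?_)
    simp only [Matrix.updateRow_apply]
    split_ifs
    · exact contMDiffAt_const
    · exact hG k l
  refine hs.congr_of_eventuallyEq ?_
  filter_upwards [hco] with q hq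
  rw [hq]
  rfl

end Smoothness

end PseudoRiemannianMetric

end LeviCivita

/-! ### The curvature tensor -/

section AlgebraicCurvature

/-- A function of four vectors with the symmetries of a Riemann curvature tensor. Linearity is
only recorded in the first slot, as the symmetries carry it to the others. -/
structure IsAlgCurvature {V : Type*} [AddCommGroup V] [Module ℝ V] (R : V → V → V → V → ℝ) :
    Prop where
  add_left (x x' y z w : V) : R (x + x') y z w = R x y z w + R x' y z w
  smul_left (c : ℝ) (x y z w : V) : R (c • x) y z w = c * R x y z w
  swap_left (x y z w : V) : R x y z w = -R y x z w
  swap_right (x y z w : V) : R x y z w = -R x y w z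
  bianchi (x y z w : V) : R x y z w + R y z x w + R z x y w = 0

end AlgebraicCurvature

section Curvature
open Filter

variable {m : ℕ} {M : Type*} [TopologicalSpace M] [ChartedSpace (EuclideanSpace ℝ (Fin m)) M]
  [IsManifold (𝓡 m) ∞ M]

/-- An operation on vector fields which is local at `p`, additive, and homogeneous over smooth
functions takes the same value on smooth vector fields with the same value at `p`. Unlike in
`TensorialAt.pointwise`, these laws are only required for vector fields smooth at `p`. -/
theorem eq_of_smooth_tensorial {A : Type*} [AddCommGroup A] [Module ℝ A] {p : M}
    (F : (Π q : M, TangentSpace (𝓡 m) q) → A)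
    (hloc : ∀ X X' : Π q : M, TangentSpace (𝓡 m) q, X =ᶠ[𝓝 p] X' → F X = F X')
    (hadd : ∀ X X' : Π q : M, TangentSpace (𝓡 m) q, ContMDiffAt (𝓡 m) (𝓡 m).tangent ∞ (T% X) p →
      ContMDiffAt (𝓡 m) (𝓡 m).tangent ∞ (T% X') p → F (X + X') = F X + F X')
    (hsmul : ∀ (f : M → ℝ) (X : Π q : M, TangentSpace (𝓡 m) q), ContMDiffAt (𝓡 m) 𝓘(ℝ, ℝ) ∞ f p →
      ContMDiffAt (𝓡 m) (𝓡 m).tangent ∞ (T% X) p → F (f • X) = f p • F X)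
    {X X' : Π q : M, TangentSpace (𝓡 m) q} (hX : ContMDiffAt (𝓡 m) (𝓡 m).tangent ∞ (T% X) p)
    (hX' : ContMDiffAt (𝓡 m) (𝓡 m).tangent ∞ (T% X') p) (h : X p = X' p) : F X = F X' := by
  classical
  let e := trivializationAt (EuclideanSpace ℝ (Fin m)) (TangentSpace (𝓡 m)) p
  have hp : p ∈ e.baseSet := FiberBundle.mem_baseSet_trivializationAt' p
  let b := (EuclideanSpace.basisFun (Fin m) ℝ).toBasis
  let E := e.localFrame b
  let c := e.localFrameCoeff (𝓡 m) b
  have hE : ∀ i, ContMDiffAt (𝓡 m) (𝓡 m).tangent ∞ (T% (E i)) p := fun i ↦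
    contMDiffAt_localFrame_of_mem ∞ e b i hp
  have hc : ∀ {X : Π q : M, TangentSpace (𝓡 m) q}, ContMDiffAt (𝓡 m) (𝓡 m).tangent ∞ (T% X) p →
      ∀ i, ContMDiffAt (𝓡 m) 𝓘(ℝ, ℝ) ∞ (fun q ↦ c i q (X q)) p := fun hX i ↦
    contMDiffAt_localFrameCoeff b hp hX i
  have hsum : ∀ f : Fin m → M → ℝ, (∀ i, ContMDiffAt (𝓡 m) 𝓘(ℝ, ℝ) ∞ (f i) p) →
      ∀ s : Finset (Fin m), ContMDiffAt (𝓡 m) (𝓡 m).tangent ∞ (T% (∑ i ∈ s, f i • E i)) p ∧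
        F (∑ i ∈ s, f i • E i) = ∑ i ∈ s, f i p • F (E i) := by
    intro f hf s
    have hz : ContMDiffAt (𝓡 m) (𝓡 m).tangent ∞ (T% (0 : Π q : M, TangentSpace (𝓡 m) q)) p :=
      contMDiff_zeroSection ℝ _ p
    induction s using Finset.induction_on with
    | empty =>
      refine ⟨by simpa using hz, ?_⟩
      have := hsmul (fun _ ↦ 0) 0 contMDiffAt_const hz
      simpa using this
    | insert i s hi ih =>
      have h1 := (hf i).smul_section (hE i)
      rw [Finset.sum_insert hi, Finset.sum_insert hi]
      refine ⟨h1.add_section ih.1, ?_⟩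
      rw [hadd _ _ h1 ih.1, ih.2, hsmul _ _ (hf i) (hE i)]
  have hexp : ∀ {X : Π q : M, TangentSpace (𝓡 m) q}, ContMDiffAt (𝓡 m) (𝓡 m).tangent ∞ (T% X) p →
      F X = ∑ i, c i p (X p) • F (E i) := by
    intro X hX
    rw [hloc X (∑ i, (fun q ↦ c i q (X q)) • E i) ?_, (hsum _ (hc hX) _).2]
    filter_upwards [e.eventually_eq_localFrame_sum_coeff_smul (I := 𝓡 m) b hp (s := X)] with q hq
    rw [hq]
    simp [E, c]
    rfl
  rw [hexp hX, hexp hX', h]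

namespace PseudoRiemannianMetric

variable (g : PseudoRiemannianMetric m M)
variable {X X' Y Y' Z Z' W : Π q : M, TangentSpace (𝓡 m) q} {f : M → ℝ} {p : M}

theorem leviCivita_zero_left (hY : MDifferentiableAt (𝓡 m) (𝓡 m).tangent (T% Y) p) :
    g.leviCivita 0 Y p = 0 := by
  have h0 : MDifferentiableAt (𝓡 m) (𝓡 m).tangent (T% (0 : Π q : M, TangentSpace (𝓡 m) q)) p :=
    (contMDiff_zeroSection (n := 1) ℝ _).mdifferentiableAt (by simp)
  have := g.leviCivita_smul_left (f := fun _ ↦ 0) mdifferentiableAt_const h0 hY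
  rwa [smul_zero, zero_smul] at this

theorem leviCivita_zero_right (hX : MDifferentiableAt (𝓡 m) (𝓡 m).tangent (T% X) p) :
    g.leviCivita X 0 p = 0 := by
  have h0 : MDifferentiableAt (𝓡 m) (𝓡 m).tangent (T% (0 : Π q : M, TangentSpace (𝓡 m) q)) p :=
    (contMDiff_zeroSection (n := 1) ℝ _).mdifferentiableAt (by simp)
  have := g.leviCivita_add_right hX h0 h0
  rwa [add_zero, left_eq_add] at this

theorem leviCivita_neg_left (hX : MDifferentiableAt (𝓡 m) (𝓡 m).tangent (T% X) p)
    (hY : MDifferentiableAt (𝓡 m) (𝓡 m).tangent (T% Y) p) :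
    g.leviCivita (-X) Y p = -g.leviCivita X Y p := by
  have := g.leviCivita_smul_left (f := fun _ ↦ -1) mdifferentiableAt_const hX hY
  have e : -X = (fun _ : M ↦ (-1 : ℝ)) • X := by ext1 q; simp
  rw [e, this, neg_one_smul]

theorem leviCivita_neg_right (hX : MDifferentiableAt (𝓡 m) (𝓡 m).tangent (T% X) p)
    (hY : MDifferentiableAt (𝓡 m) (𝓡 m).tangent (T% Y) p) :
    g.leviCivita X (-Y) p = -g.leviCivita X Y p := by
  have := g.leviCivita_smul_right (f := fun _ ↦ -1) mdifferentiableAt_const hX hY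
  have e : -Y = (fun _ : M ↦ (-1 : ℝ)) • Y := by ext1 q; simp
  rw [e, this, mvfderiv_const, zero_apply, zero_smul, zero_add, neg_one_smul]

theorem leviCivita_sub_right (hX : MDifferentiableAt (𝓡 m) (𝓡 m).tangent (T% X) p)
    (hY : MDifferentiableAt (𝓡 m) (𝓡 m).tangent (T% Y) p)
    (hY' : MDifferentiableAt (𝓡 m) (𝓡 m).tangent (T% Y') p) :
    g.leviCivita X (Y - Y') p = g.leviCivita X Y p - g.leviCivita X Y' p := by
  rw [sub_eq_add_neg, g.leviCivita_add_right hX hY (mdifferentiableAt_neg_section hY'),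
    g.leviCivita_neg_right hX hY', sub_eq_add_neg]

theorem leviCivita_congr_right (X : Π q : M, TangentSpace (𝓡 m) q) (hY : Y =ᶠ[𝓝 p] Y') :
    g.leviCivita X Y p = g.leviCivita X Y' p :=
  g.leviCivita_congr (EventuallyEq.refl _ X) hY

theorem curvatureOperator_congr (hX : X =ᶠ[𝓝 p] X') (hY : Y =ᶠ[𝓝 p] Y') (hZ : Z =ᶠ[𝓝 p] Z') :
    g.curvatureOperator X Y Z p = g.curvatureOperator X' Y' Z' p := by
  simp only [curvatureOperator]
  rw [g.leviCivita_congr hX (g.leviCivita_eventuallyEq hY hZ),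
    g.leviCivita_congr hY (g.leviCivita_eventuallyEq hX hZ),
    g.leviCivita_congr (hX.mlieBracket_vectorField hY) hZ]

theorem curvatureOperator_swap (hX : ContMDiffAt (𝓡 m) (𝓡 m).tangent ∞ (T% X) p)
    (hY : ContMDiffAt (𝓡 m) (𝓡 m).tangent ∞ (T% Y) p)
    (hZ : ContMDiffAt (𝓡 m) (𝓡 m).tangent ∞ (T% Z) p) :
    g.curvatureOperator X Y Z p = -g.curvatureOperator Y X Z p := by
  simp only [curvatureOperator]
  rw [mlieBracket_swap, g.leviCivita_neg_left (hY.mlieBracket_infty hX).mdiff_infty hZ.mdiff_infty]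
  abel

theorem curvatureOperator_add_left (hX : ContMDiffAt (𝓡 m) (𝓡 m).tangent ∞ (T% X) p)
    (hX' : ContMDiffAt (𝓡 m) (𝓡 m).tangent ∞ (T% X') p)
    (hY : ContMDiffAt (𝓡 m) (𝓡 m).tangent ∞ (T% Y) p)
    (hZ : ContMDiffAt (𝓡 m) (𝓡 m).tangent ∞ (T% Z) p) :
    g.curvatureOperator (X + X') Y Z p =
      g.curvatureOperator X Y Z p + g.curvatureOperator X' Y Z p := by
  simp only [curvatureOperator]
  have e1 : g.leviCivita (X + X') Z =ᶠ[𝓝 p] g.leviCivita X Z + g.leviCivita X' Z := by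
    filter_upwards [hX.eventually_mdiff, hX'.eventually_mdiff, hZ.eventually_mdiff] with q h1 h2 h3
    exact g.leviCivita_add_left h1 h2 h3
  have e2 : mlieBracket (𝓡 m) (X + X') Y =ᶠ[𝓝 p] mlieBracket (𝓡 m) X Y + mlieBracket (𝓡 m) X' Y := by
    filter_upwards [hX.eventually_mdiff, hX'.eventually_mdiff] with q h1 h2
    exact mlieBracket_add_left h1 h2
  rw [g.leviCivita_congr_right _ e1, g.leviCivita_congr e2 (EventuallyEq.refl _ Z),
    g.leviCivita_add_left hX.mdiff_infty hX'.mdiff_infty (g.contMDiffAt_leviCivita hY hZ).mdiff_infty,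
    g.leviCivita_add_right hY.mdiff_infty (g.contMDiffAt_leviCivita hX hZ).mdiff_infty
      (g.contMDiffAt_leviCivita hX' hZ).mdiff_infty,
    g.leviCivita_add_left (hX.mlieBracket_infty hY).mdiff_infty (hX'.mlieBracket_infty hY).mdiff_infty
      hZ.mdiff_infty]
  abel

theorem curvatureOperator_smul_left (hf : ContMDiffAt (𝓡 m) 𝓘(ℝ, ℝ) ∞ f p)
    (hX : ContMDiffAt (𝓡 m) (𝓡 m).tangent ∞ (T% X) p)
    (hY : ContMDiffAt (𝓡 m) (𝓡 m).tangent ∞ (T% Y) p)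
    (hZ : ContMDiffAt (𝓡 m) (𝓡 m).tangent ∞ (T% Z) p) :
    g.curvatureOperator (f • X) Y Z p = f p • g.curvatureOperator X Y Z p := by
  simp only [curvatureOperator]
  have hf' : MDifferentiableAt (𝓡 m) 𝓘(ℝ, ℝ) f p := hf.mdifferentiableAt (by simp)
  have e1 : g.leviCivita (f • X) Z =ᶠ[𝓝 p] f • g.leviCivita X Z := by
    filter_upwards [hf.eventually_mdiff_fun, hX.eventually_mdiff, hZ.eventually_mdiff] with q h1 h2 h3
    exact g.leviCivita_smul_left h1 h2 h3
  have e2 : mlieBracket (𝓡 m) (f • X) Y =ᶠ[𝓝 p]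
      (fun q ↦ -mvfderiv (𝓡 m) f q (Y q)) • X + f • mlieBracket (𝓡 m) X Y := by
    filter_upwards [hf.eventually_mdiff_fun, hX.eventually_mdiff] with q h1 h2
    exact mlieBracket_smul_left h1 h2
  have hfY := (contMDiffAt_mvfderiv_apply hY hf).neg
  have hB := hX.mlieBracket_infty hY
  rw [g.leviCivita_congr_right _ e1, g.leviCivita_congr e2 (EventuallyEq.refl _ Z),
    g.leviCivita_smul_left hf' hX.mdiff_infty (g.contMDiffAt_leviCivita hY hZ).mdiff_infty,
    g.leviCivita_smul_right hf' hY.mdiff_infty (g.contMDiffAt_leviCivita hX hZ).mdiff_infty,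
    g.leviCivita_add_left (hfY.smul_section hX).mdiff_infty (hf.smul_section hB).mdiff_infty
      hZ.mdiff_infty,
    g.leviCivita_smul_left (hfY.mdifferentiableAt (by simp)) hX.mdiff_infty hZ.mdiff_infty,
    g.leviCivita_smul_left hf' hB.mdiff_infty hZ.mdiff_infty]
  module

theorem curvatureOperator_add_right (hX : ContMDiffAt (𝓡 m) (𝓡 m).tangent ∞ (T% X) p)
    (hY : ContMDiffAt (𝓡 m) (𝓡 m).tangent ∞ (T% Y) p)
    (hZ : ContMDiffAt (𝓡 m) (𝓡 m).tangent ∞ (T% Z) p)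
    (hZ' : ContMDiffAt (𝓡 m) (𝓡 m).tangent ∞ (T% Z') p) :
    g.curvatureOperator X Y (Z + Z') p =
      g.curvatureOperator X Y Z p + g.curvatureOperator X Y Z' p := by
  simp only [curvatureOperator]
  have e1 : ∀ {X : Π q : M, TangentSpace (𝓡 m) q}, ContMDiffAt (𝓡 m) (𝓡 m).tangent ∞ (T% X) p →
      g.leviCivita X (Z + Z') =ᶠ[𝓝 p] g.leviCivita X Z + g.leviCivita X Z' := by
    intro X hX
    filter_upwards [hX.eventually_mdiff, hZ'.eventually_mdiff, hZ.eventually_mdiff] with q h1 h2 h3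
    exact g.leviCivita_add_right h1 h3 h2
  rw [g.leviCivita_congr_right _ (e1 hX), g.leviCivita_congr_right _ (e1 hY),
    g.leviCivita_add_right hX.mdiff_infty (g.contMDiffAt_leviCivita hY hZ).mdiff_infty
      (g.contMDiffAt_leviCivita hY hZ').mdiff_infty,
    g.leviCivita_add_right hY.mdiff_infty (g.contMDiffAt_leviCivita hX hZ).mdiff_infty
      (g.contMDiffAt_leviCivita hX hZ').mdiff_infty,
    g.leviCivita_add_right (hX.mlieBracket_infty hY).mdiff_infty hZ.mdiff_infty hZ'.mdiff_infty]
  abel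

theorem curvatureOperator_smul_right (hf : ContMDiffAt (𝓡 m) 𝓘(ℝ, ℝ) ∞ f p)
    (hX : ContMDiffAt (𝓡 m) (𝓡 m).tangent ∞ (T% X) p)
    (hY : ContMDiffAt (𝓡 m) (𝓡 m).tangent ∞ (T% Y) p)
    (hZ : ContMDiffAt (𝓡 m) (𝓡 m).tangent ∞ (T% Z) p) :
    g.curvatureOperator X Y (f • Z) p = f p • g.curvatureOperator X Y Z p := by
  simp only [curvatureOperator]
  have hf' : MDifferentiableAt (𝓡 m) 𝓘(ℝ, ℝ) f p := hf.mdifferentiableAt (by simp)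
  have e1 : ∀ {X : Π q : M, TangentSpace (𝓡 m) q}, ContMDiffAt (𝓡 m) (𝓡 m).tangent ∞ (T% X) p →
      g.leviCivita X (f • Z) =ᶠ[𝓝 p]
        (fun q ↦ mvfderiv (𝓡 m) f q (X q)) • Z + f • g.leviCivita X Z := by
    intro X hX
    filter_upwards [hX.eventually_mdiff, hf.eventually_mdiff_fun, hZ.eventually_mdiff] with q h1 h2 h3
    exact g.leviCivita_smul_right h2 h1 h3
  have e2 : ∀ {X Y : Π q : M, TangentSpace (𝓡 m) q}, ContMDiffAt (𝓡 m) (𝓡 m).tangent ∞ (T% X) p →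
      ContMDiffAt (𝓡 m) (𝓡 m).tangent ∞ (T% Y) p →
      g.leviCivita X (g.leviCivita Y (f • Z)) p =
        mvfderiv (𝓡 m) (fun q ↦ mvfderiv (𝓡 m) f q (Y q)) p (X p) • Z p
        + mvfderiv (𝓡 m) f p (Y p) • g.leviCivita X Z p
        + (mvfderiv (𝓡 m) f p (X p) • g.leviCivita Y Z p
          + f p • g.leviCivita X (g.leviCivita Y Z) p) := by
    intro X Y hX hY
    have h1 := contMDiffAt_mvfderiv_apply hY hf
    have h2 := g.contMDiffAt_leviCivita hY hZ
    rw [g.leviCivita_congr_right _ (e1 hY), g.leviCivita_add_right hX.mdiff_infty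
      (h1.smul_section hZ).mdiff_infty (hf.smul_section h2).mdiff_infty,
      g.leviCivita_smul_right (h1.mdifferentiableAt (by simp)) hX.mdiff_infty hZ.mdiff_infty,
      g.leviCivita_smul_right hf' hX.mdiff_infty h2.mdiff_infty]
  rw [e2 hX hY, e2 hY hX, g.leviCivita_smul_right hf' (hX.mlieBracket_infty hY).mdiff_infty
    hZ.mdiff_infty, mvfderiv_mlieBracket hX hY hf]
  module

/-- The curvature operator `R(X, Y) Z` at `p` depends only on the values of the smooth fields
`X`, `Y`, `Z` at `p`. -/
theorem curvatureOperator_pointwise (hX : ContMDiffAt (𝓡 m) (𝓡 m).tangent ∞ (T% X) p)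
    (hX' : ContMDiffAt (𝓡 m) (𝓡 m).tangent ∞ (T% X') p)
    (hY : ContMDiffAt (𝓡 m) (𝓡 m).tangent ∞ (T% Y) p)
    (hY' : ContMDiffAt (𝓡 m) (𝓡 m).tangent ∞ (T% Y') p)
    (hZ : ContMDiffAt (𝓡 m) (𝓡 m).tangent ∞ (T% Z) p)
    (hZ' : ContMDiffAt (𝓡 m) (𝓡 m).tangent ∞ (T% Z') p)
    (h : X p = X' p) (h' : Y p = Y' p) (h'' : Z p = Z' p) :
    g.curvatureOperator X Y Z p = g.curvatureOperator X' Y' Z' p := by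
  have key : ∀ {X X' Y Z : Π q : M, TangentSpace (𝓡 m) q},
      ContMDiffAt (𝓡 m) (𝓡 m).tangent ∞ (T% X) p → ContMDiffAt (𝓡 m) (𝓡 m).tangent ∞ (T% X') p →
      ContMDiffAt (𝓡 m) (𝓡 m).tangent ∞ (T% Y) p → ContMDiffAt (𝓡 m) (𝓡 m).tangent ∞ (T% Z) p →
      X p = X' p → g.curvatureOperator X Y Z p = g.curvatureOperator X' Y Z p := by
    intro X X' Y Z hX hX' hY hZ h
    exact eq_of_smooth_tensorial (fun X ↦ g.curvatureOperator X Y Z p)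
      (fun _ _ h ↦ g.curvatureOperator_congr h (EventuallyEq.refl _ Y) (EventuallyEq.refl _ Z))
      (fun _ _ h h' ↦ g.curvatureOperator_add_left h h' hY hZ)
      (fun _ _ h h' ↦ g.curvatureOperator_smul_left h h' hY hZ) hX hX' h
  have h3 : g.curvatureOperator X' Y' Z p = g.curvatureOperator X' Y' Z' p :=
    eq_of_smooth_tensorial (fun Z ↦ g.curvatureOperator X' Y' Z p)
      (fun _ _ h ↦ g.curvatureOperator_congr (EventuallyEq.refl _ X') (EventuallyEq.refl _ Y') h)
      (fun _ _ h h' ↦ g.curvatureOperator_add_right hX' hY' h h')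
      (fun _ _ h h' ↦ g.curvatureOperator_smul_right h hX' hY' h') hZ hZ' h''
  rw [key hX hX' hY hZ h, g.curvatureOperator_swap hX' hY hZ, key hY hY' hX' hZ h',
    ← g.curvatureOperator_swap hX' hY' hZ, h3]

/-- The curvature tensor at a point can be computed from any smooth extensions. -/
theorem curvature_eq (hX : ContMDiffAt (𝓡 m) (𝓡 m).tangent ∞ (T% X) p)
    (hY : ContMDiffAt (𝓡 m) (𝓡 m).tangent ∞ (T% Y) p)
    (hZ : ContMDiffAt (𝓡 m) (𝓡 m).tangent ∞ (T% Z) p) (w : TangentSpace (𝓡 m) p) :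
    g.curvature p (X p) (Y p) (Z p) w = g.inner p (g.curvatureOperator X Y Z p) w := by
  have hs := fun v : TangentSpace (𝓡 m) p ↦
    FiberBundle.contMDiffAt_extend (k := ∞) (𝓡 m) (EuclideanSpace ℝ (Fin m)) v
  rw [curvature, g.curvatureOperator_pointwise (hs _) hX (hs _) hY (hs _) hZ]
  all_goals exact FiberBundle.extend_apply_self _ _

theorem mvfderiv_mvfderiv_inner (hX : ContMDiffAt (𝓡 m) (𝓡 m).tangent ∞ (T% X) p)
    (hY : ContMDiffAt (𝓡 m) (𝓡 m).tangent ∞ (T% Y) p)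
    (hZ : ContMDiffAt (𝓡 m) (𝓡 m).tangent ∞ (T% Z) p)
    (hW : ContMDiffAt (𝓡 m) (𝓡 m).tangent ∞ (T% W) p) :
    mvfderiv (𝓡 m) (fun q ↦ mvfderiv (𝓡 m) (fun q : M ↦ g.inner q (Z q) (W q)) q (Y q)) p (X p) =
      g.inner p (g.leviCivita X (g.leviCivita Y Z) p) (W p)
      + g.inner p (g.leviCivita Y Z p) (g.leviCivita X W p)
      + (g.inner p (g.leviCivita X Z p) (g.leviCivita Y W p)
      + g.inner p (Z p) (g.leviCivita X (g.leviCivita Y W) p)) := by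
  have e : (fun q ↦ mvfderiv (𝓡 m) (fun q : M ↦ g.inner q (Z q) (W q)) q (Y q)) =ᶠ[𝓝 p]
      fun q ↦ g.inner q (g.leviCivita Y Z q) (W q) + g.inner q (Z q) (g.leviCivita Y W q) := by
    filter_upwards [hY.eventually_mdiff, hZ.eventually_mdiff, hW.eventually_mdiff] with q h1 h2 h3
    exact g.mvfderiv_inner h1 h2 h3
  have h1 := g.contMDiffAt_leviCivita hY hZ
  have h2 := g.contMDiffAt_leviCivita hY hW
  rw [mvfderiv_congr_of_eventuallyEq e, mvfderiv_fun_add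
    (g.mdifferentiableAt_inner h1.mdiff_infty hW.mdiff_infty)
    (g.mdifferentiableAt_inner hZ.mdiff_infty h2.mdiff_infty), add_apply,
    g.mvfderiv_inner hX.mdiff_infty h1.mdiff_infty hW.mdiff_infty,
    g.mvfderiv_inner hX.mdiff_infty hZ.mdiff_infty h2.mdiff_infty]

theorem inner_curvatureOperator_swap (hX : ContMDiffAt (𝓡 m) (𝓡 m).tangent ∞ (T% X) p)
    (hY : ContMDiffAt (𝓡 m) (𝓡 m).tangent ∞ (T% Y) p)
    (hZ : ContMDiffAt (𝓡 m) (𝓡 m).tangent ∞ (T% Z) p)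
    (hW : ContMDiffAt (𝓡 m) (𝓡 m).tangent ∞ (T% W) p) :
    g.inner p (g.curvatureOperator X Y Z p) (W p) =
      -g.inner p (g.curvatureOperator X Y W p) (Z p) := by
  have h := mvfderiv_mlieBracket hX hY (g.contMDiffAt_inner hZ hW)
  rw [g.mvfderiv_mvfderiv_inner hX hY hZ hW, g.mvfderiv_mvfderiv_inner hY hX hZ hW,
    g.mvfderiv_inner (hX.mlieBracket_infty hY).mdiff_infty hZ.mdiff_infty hW.mdiff_infty] at h
  simp only [curvatureOperator, map_sub, sub_apply]
  rw [g.symm p _ (Z p), g.symm p _ (Z p), g.symm p _ (Z p)]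
  linarith

/-- For commuting fields, `R(X, Y) Z` is the commutator of `∇_X` and `∇_Y`. -/
theorem curvatureOperator_of_commute (hZ : ContMDiffAt (𝓡 m) (𝓡 m).tangent ∞ (T% Z) p)
    (h : ∀ᶠ q in 𝓝 p, mlieBracket (𝓡 m) X Y q = 0) :
    g.curvatureOperator X Y Z p =
      g.leviCivita X (g.leviCivita Y Z) p - g.leviCivita Y (g.leviCivita X Z) p := by
  have e : mlieBracket (𝓡 m) X Y =ᶠ[𝓝 p] (0 : Π q : M, TangentSpace (𝓡 m) q) := h
  rw [curvatureOperator, g.leviCivita_congr e (EventuallyEq.refl _ Z),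
    g.leviCivita_zero_left hZ.mdiff_infty, sub_zero]

/-- Commuting fields satisfy `∇_X Y = ∇_Y X`. -/
theorem leviCivita_comm_of_commute (hX : ContMDiffAt (𝓡 m) (𝓡 m).tangent ∞ (T% X) p)
    (hY : ContMDiffAt (𝓡 m) (𝓡 m).tangent ∞ (T% Y) p)
    (h : ∀ᶠ q in 𝓝 p, mlieBracket (𝓡 m) X Y q = 0) :
    g.leviCivita X Y =ᶠ[𝓝 p] g.leviCivita Y X := by
  filter_upwards [h, hX.eventually_mdiff, hY.eventually_mdiff] with q h h1 h2
  have := g.leviCivita_sub_swap h1 h2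
  rw [h] at this
  exact sub_eq_zero.1 this

/-- The curvature tensor at a point is an algebraic curvature tensor. -/
theorem isAlgCurvature_curvature (p : M) : IsAlgCurvature (g.curvature p) := by
  have hs := fun v : TangentSpace (𝓡 m) p ↦ contMDiffAt_coordField v
  have hv := fun v : TangentSpace (𝓡 m) p ↦ coordField_self v
  refine ⟨fun x x' y z w ↦ ?_, fun c x y z w ↦ ?_, fun x y z w ↦ ?_, fun x y z w ↦ ?_,
    fun x y z w ↦ ?_⟩
  · have h := g.curvature_eq ((hs x).add_section (hs x')) (hs y) (hs z) w
    rw [Pi.add_apply, hv, hv, hv, hv, g.curvatureOperator_add_left (hs _) (hs _) (hs _) (hs _)] at h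
    rw [h, map_add, add_apply]
    rfl
  · have hc : ContMDiffAt (𝓡 m) 𝓘(ℝ, ℝ) ∞ (fun _ : M ↦ c) p := contMDiffAt_const
    have h := g.curvature_eq (hc.smul_section (hs x)) (hs y) (hs z) w
    rw [Pi.smul_apply', hv, hv, hv, g.curvatureOperator_smul_left hc (hs _) (hs _) (hs _)] at h
    rw [h, map_smul, smul_apply]
    rfl
  · rw [curvature, curvature, g.curvatureOperator_swap (hs x) (hs y) (hs z), map_neg, neg_apply]
  · have h := g.inner_curvatureOperator_swap (hs x) (hs y) (hs z) (hs w)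
    rw [hv, hv] at h
    exact h
  · have hc := fun v w : TangentSpace (𝓡 m) p ↦ mlieBracket_coordField v w
    simp only [curvature]
    rw [g.curvatureOperator_of_commute (hs z) (hc x y), g.curvatureOperator_of_commute (hs x) (hc y z),
      g.curvatureOperator_of_commute (hs y) (hc z x),
      g.leviCivita_congr_right _ (g.leviCivita_comm_of_commute (hs y) (hs z) (hc y z)),
      g.leviCivita_congr_right _ (g.leviCivita_comm_of_commute (hs x) (hs z) (hc x z)),
      g.leviCivita_congr_right _ (g.leviCivita_comm_of_commute (hs y) (hs x) (hc y x))]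
    simp only [map_sub, sub_apply]
    ring

end PseudoRiemannianMetric

end Curvature

/-! ### Algebra of paracontact tangent spaces -/

section ParacontactAlgebra

variable {V : Type*} [AddCommGroup V] [Module ℝ V]

namespace IsAlgCurvature

variable {R R' : V → V → V → V → ℝ}

/-- The pair symmetry is a combination of four Bianchi identities. -/
theorem pair_symm (h : IsAlgCurvature R) (x y z w : V) : R x y z w = R z w x y := by
  have b1 := h.bianchi x y z w
  have b2 := h.bianchi y z w x
  have b3 := h.bianchi z w x y
  have b4 := h.bianchi w x y z
  have s1 := h.swap_right y z x w
  have s4 := h.swap_right z w y x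
  have s9 := h.swap_right x y z w
  have s11 := h.swap_right w x z y
  have s14 := h.swap_right y w x z
  have s16 := h.swap_left y w z x
  have s18 := h.swap_left x z y w
  have s19 := h.swap_right x z y w
  linarith

theorem add_two (h : IsAlgCurvature R) (x y y' z w : V) : R x (y + y') z w = R x y z w + R x y' z w := by
  rw [h.swap_left, h.add_left, h.swap_left x y, h.swap_left x y']; ring

theorem smul_two (h : IsAlgCurvature R) (c : ℝ) (x y z w : V) : R x (c • y) z w = c * R x y z w := by
  rw [h.swap_left, h.smul_left, h.swap_left x y]; ring

theorem add_three (h : IsAlgCurvature R) (x y z z' w : V) : R x y (z + z') w = R x y z w + R x y z' w := by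
  rw [h.pair_symm, h.add_left, h.pair_symm z, h.pair_symm z']

theorem smul_three (h : IsAlgCurvature R) (c : ℝ) (x y z w : V) : R x y (c • z) w = c * R x y z w := by
  rw [h.pair_symm, h.smul_left, ← h.pair_symm]

theorem add_four (h : IsAlgCurvature R) (x y z w w' : V) : R x y z (w + w') = R x y z w + R x y z w' := by
  rw [h.pair_symm, h.add_two, h.pair_symm z w, h.pair_symm z w']

theorem smul_four (h : IsAlgCurvature R) (c : ℝ) (x y z w : V) : R x y z (c • w) = c * R x y z w := by
  rw [h.pair_symm, h.smul_two, ← h.pair_symm]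

theorem sub (h : IsAlgCurvature R) (h' : IsAlgCurvature R') :
    IsAlgCurvature fun x y z w ↦ R x y z w - R' x y z w where
  add_left x x' y z w := by rw [h.add_left, h'.add_left]; ring
  smul_left c x y z w := by rw [h.smul_left, h'.smul_left]; ring
  swap_left x y z w := by rw [h.swap_left, h'.swap_left]; ring
  swap_right x y z w := by rw [h.swap_right, h'.swap_right]; ring
  bianchi x y z w := by linarith [h.bianchi x y z w, h'.bianchi x y z w]

/-- An algebraic curvature tensor is determined by its values `R(x, y, y, x)`. -/
theorem eq_zero_of_diag (h : IsAlgCurvature R) (h0 : ∀ x y, R x y y x = 0) (x y z w : V) :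
    R x y z w = 0 := by
  have h1 : ∀ x y z, R x y z x = 0 := by
    intro x y z
    have e := h0 x (y + z)
    rw [h.add_two, h.add_three, h.add_three, h0, h0] at e
    have e' : R x z y x = R x y z x := by
      rw [h.pair_symm, h.swap_left, h.swap_right, neg_neg]
    linarith
  have h2 : ∀ x y z w, R x y z w = -R w y z x := by
    intro x y z w
    have e := h1 (x + w) y z
    rw [h.add_left, h.add_four, h.add_four, h1, h1] at e
    linarith
  have b := h.bianchi x y z w
  have e1 := h2 x y z w
  have e2 := h2 y z x w
  have e4 := h.swap_left w y z x
  have e5 := h.swap_right y w z x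
  have e6 := h2 y w x z
  have e9 := h2 w z y x
  have e10 := h.swap_left x z y w
  have e16 := h.swap_left w z x y
  have e17 := h.swap_right w z x y
  linarith

end IsAlgCurvature

/-- The algebraic identities of a paracontact metric structure on a tangent space, for the metric
`g`, the endomorphism `φ`, the vector `ξ` and the covector `η`. -/
structure IsParacontact (g : V → V → ℝ) (φ : V → V) (ξ : V) (η : V → ℝ) : Prop where
  g_add (x x' y : V) : g (x + x') y = g x y + g x' y
  g_smul (c : ℝ) (x y : V) : g (c • x) y = c * g x y
  g_symm (x y : V) : g x y = g y x
  g_ext (x y : V) (h : ∀ z, g x z = g y z) : x = y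
  φ_add (x y : V) : φ (x + y) = φ x + φ y
  φ_smul (c : ℝ) (x : V) : φ (c • x) = c • φ x
  η_add (x y : V) : η (x + y) = η x + η y
  η_smul (c : ℝ) (x : V) : η (c • x) = c * η x
  φ_ξ : φ ξ = 0
  η_φ (x : V) : η (φ x) = 0
  η_ξ : η ξ = 1
  φ_φ (x : V) : φ (φ x) = x - η x • ξ
  g_φ_φ (x y : V) : g (φ x) (φ y) = -g x y + η x * η y

namespace IsParacontact

variable {g : V → V → ℝ} {φ : V → V} {ξ : V} {η : V → ℝ} (P : IsParacontact g φ ξ η)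
include P

theorem g_add_right (x y y' : V) : g x (y + y') = g x y + g x y' := by
  rw [P.g_symm, P.g_add, P.g_symm y, P.g_symm y']

theorem g_smul_right (c : ℝ) (x y : V) : g x (c • y) = c * g x y := by
  rw [P.g_symm, P.g_smul, P.g_symm y]

theorem g_zero_left (y : V) : g 0 y = 0 := by
  have := P.g_smul 0 0 y
  simpa using this

theorem g_zero_right (x : V) : g x 0 = 0 := by rw [P.g_symm, P.g_zero_left]

theorem g_sub (x x' y : V) : g (x - x') y = g x y - g x' y := by
  rw [sub_eq_add_neg, P.g_add, ← neg_one_smul ℝ x', P.g_smul]; ring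

theorem g_sub_right (x y y' : V) : g x (y - y') = g x y - g x y' := by
  rw [P.g_symm, P.g_sub, P.g_symm y, P.g_symm y']

theorem g_ξ (x : V) : g x ξ = η x := by
  have := P.g_φ_φ x ξ
  rw [P.φ_ξ, P.g_zero_right, P.η_ξ] at this
  linarith

theorem ξ_g (x : V) : g ξ x = η x := by rw [P.g_symm, P.g_ξ]

theorem g_φ_left (x y : V) : g (φ x) y = -g x (φ y) := by
  have := P.g_φ_φ x (φ y)
  rw [P.φ_φ, P.η_φ, P.g_sub_right, P.g_smul_right, P.g_ξ, P.η_φ] at this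
  linarith

theorem g_φ_self (x : V) : g x (φ x) = 0 := by
  have := P.g_φ_left x x
  rw [P.g_symm] at this
  linarith

theorem g_φ_comm (x y : V) : g x (φ y) = -g y (φ x) := by
  rw [P.g_symm, P.g_φ_left]

theorem φ_φ_φ (x : V) : φ (φ (φ x)) = φ x := by
  rw [P.φ_φ (φ x), P.η_φ, zero_smul, sub_zero]

end IsParacontact

/-- The curvature tensor of constant paraholomorphic sectional curvature `k`. -/
def paraCurvatureForm (g : V → V → ℝ) (φ : V → V) (η : V → ℝ) (k : ℝ) (x y z w : V) : ℝ :=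
  (k - 3) / 4 * (g x w * g z y - g y w * g z x)
  + (k + 1) / 4 * (g z x * η y * η w + g w y * η x * η z - g w x * η y * η z - g z y * η w * η x
    + g z (φ y) * g x (φ w) - g z (φ x) * g y (φ w) + 2 * g x (φ y) * g z (φ w))

namespace IsParacontact

variable {g : V → V → ℝ} {φ : V → V} {ξ : V} {η : V → ℝ} (P : IsParacontact g φ ξ η)
include P

theorem isAlgCurvature_form (k : ℝ) : IsAlgCurvature (paraCurvatureForm g φ η k) where
  add_left x x' y z w := by
    simp only [paraCurvatureForm, P.g_add, P.g_add_right, P.η_add, P.φ_add]; ring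
  smul_left c x y z w := by
    simp only [paraCurvatureForm, P.g_smul, P.g_smul_right, P.η_smul, P.φ_smul]; ring
  swap_left x y z w := by
    simp only [paraCurvatureForm]
    rw [P.g_symm w x, P.g_symm w y, P.g_φ_comm y x]; ring
  swap_right x y z w := by
    simp only [paraCurvatureForm]
    rw [P.g_symm w x, P.g_symm w y, P.g_symm z x, P.g_symm z y, P.g_φ_comm w z, P.g_φ_comm w y,
      P.g_φ_comm w x, P.g_φ_comm z x, P.g_φ_comm z y]; ring
  bianchi x y z w := by
    simp only [paraCurvatureForm]
    rw [P.g_symm w x, P.g_symm w y, P.g_symm w z, P.g_symm z x, P.g_symm z y, P.g_symm y x,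
      P.g_φ_comm z y, P.g_φ_comm z x, P.g_φ_comm y x]; ring

theorem form_ξ (k : ℝ) (x y z : V) :
    paraCurvatureForm g φ η k x y z ξ = -(g z y * η x - g z x * η y) := by
  simp only [paraCurvatureForm, P.g_ξ, P.ξ_g, P.φ_ξ, P.η_ξ, P.g_zero_right]; ring

/-- The commutator of the curvature form with `φ` does not depend on `k`. -/
theorem form_φ (k : ℝ) (x y z w : V) :
    paraCurvatureForm g φ η k x y (φ z) w + paraCurvatureForm g φ η k x y z (φ w) =
      g y z * g (φ x) w - g x z * g (φ y) w - g (φ x) z * g y w + g (φ y) z * g x w := by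
  simp only [paraCurvatureForm, P.g_φ_left, P.φ_φ, P.g_sub_right, P.g_smul_right, P.g_ξ, P.η_φ]
  rw [P.g_symm w x, P.g_symm w y, P.g_symm z x, P.g_symm z y, P.g_φ_comm w y,
      P.g_φ_comm w x, P.g_φ_comm z x, P.g_φ_comm z y]
  ring

/-- The paraholomorphic sectional curvature of the curvature form is `k`; the sign comes from
`g(φ²x, φ²x) = -g(φx, φx)`. -/
theorem form_diag (k : ℝ) (x : V) :
    paraCurvatureForm g φ η k (φ x) (φ (φ x)) (φ (φ x)) (φ x) = -k * g (φ x) (φ x) ^ 2 := by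
  have e : g (φ (φ x)) (φ (φ x)) = -g (φ x) (φ x) := by
    rw [P.g_φ_φ, P.η_φ]; ring
  simp only [paraCurvatureForm, P.η_φ, P.φ_φ_φ, e, P.g_symm (φ (φ x)) (φ x), P.g_φ_self]
  ring

/-- A tensor with the symmetries of a para-Kähler curvature tensor on the quotient by `ξ` whose
paraholomorphic sectional curvature vanishes is zero. -/
theorem eq_zero_of_paraholomorphic {D : V → V → V → V → ℝ} (h : IsAlgCurvature D)
    (hξ : ∀ x y z, D x y z ξ = 0) (hφ : ∀ x y z w, D x y (φ z) w = -D x y z (φ w))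
    (h0 : ∀ x, D (φ x) (φ (φ x)) (φ (φ x)) (φ x) = 0) (x y z w : V) : D x y z w = 0 := by
  have four : ∀ x y z w, D x y z (φ (φ w)) = D x y z w := by
    intro x y z w
    have e := h.add_four x y z (φ (φ w)) (η w • ξ)
    rw [h.smul_four, hξ, P.φ_φ, sub_add_cancel] at e
    rw [P.φ_φ, e]; ring
  have three : ∀ x y z w, D x y (φ (φ z)) w = D x y z w := by
    intro x y z w
    rw [h.swap_right, four, ← h.swap_right]
  have one : ∀ x y z w, D (φ (φ x)) y z w = D x y z w := by
    intro x y z w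
    rw [h.pair_symm, three, h.pair_symm]
  have two : ∀ x y z w, D x (φ (φ y)) z w = D x y z w := by
    intro x y z w
    rw [h.pair_symm, four, h.pair_symm]
  have hφ' : ∀ x y z w, D (φ x) y z w = -D x (φ y) z w := by
    intro x y z w
    rw [h.pair_symm, hφ, h.pair_symm z]
  have hd : ∀ x, D x (φ x) (φ x) x = 0 := by
    intro x
    have := h0 (φ x)
    rwa [P.φ_φ_φ, one, four] at this
  refine h.eq_zero_of_diag (fun x y ↦ ?_) x y z w
  -- applying this to `x, y` and to `x, φy` gives `9 D(x, y, y, x) = D(x, y, y, x)`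
  have key : ∀ x y, 3 * D x (φ y) (φ y) x = D x y y x := by
    intro x y
    have e1 := hd (x + y)
    have e2 := hd (x + (-1 : ℝ) • y)
    simp only [P.φ_add, P.φ_smul, h.add_left, h.add_two, h.add_three, h.add_four, h.smul_left,
      h.smul_two, h.smul_three, h.smul_four, hd] at e1 e2
    -- the part of degree two in `x` and in `y`
    have e3 : D x (φ x) (φ y) y + D y (φ y) (φ x) x + D x (φ y) (φ x) y + D y (φ x) (φ y) x
        + D x (φ y) (φ y) x + D y (φ x) (φ x) y = 0 := by linarith
    have a1 : D y (φ y) (φ x) x = D x (φ x) (φ y) y := by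
      rw [h.pair_symm, h.swap_left, h.swap_right, neg_neg]
    have a2 : D y (φ x) (φ y) x = D x (φ y) (φ x) y := by
      rw [h.pair_symm, h.swap_left, h.swap_right, neg_neg]
    have a3 : D y (φ x) (φ x) y = D x (φ y) (φ y) x := by
      rw [h.pair_symm, hφ', hφ]
    have a4 : D x (φ y) (φ x) y = D x (φ y) (φ y) x := by
      rw [hφ, h.swap_right, neg_neg]
    have a5 := h.bianchi x (φ x) (φ y) y
    have a6 : D (φ x) (φ y) x y = -D x y x y := by rw [hφ', two]
    have a7 := h.swap_right x y x y
    have a8 : D (φ y) x (φ x) y = -D x (φ y) (φ x) y := h.swap_left _ _ _ _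
    linarith
  have k1 := key x y
  have k2 := key x (φ y)
  rw [two, three] at k2
  linarith

omit P in
/-- A function whose restriction to lines is continuous vanishes identically if it vanishes off the
zero set of a quadratic form which is not identically zero. -/
theorem eq_zero_of_quadratic_ne_zero {f q : V → ℝ} (hf : ∀ x y, Continuous fun t : ℝ ↦ f (x + t • y))
    {b : V → V → ℝ} (hq : ∀ (x y : V) (t : ℝ), q (x + t • y) = q x + t * b x y + t ^ 2 * q y)
    (h : ∀ x, q x ≠ 0 → f x = 0) {e : V} (he : q e ≠ 0) (x : V) : f x = 0 := by
  by_cases hx : q x = 0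
  swap
  · exact h x hx
  have h1 : ∀ᶠ t : ℝ in 𝓝[≠] 0, f (x + t • e) = 0 := by
    have hne : ∀ᶠ t : ℝ in 𝓝[≠] 0, b x e + t * q e ≠ 0 := by
      by_cases hb : b x e = 0
      · filter_upwards [self_mem_nhdsWithin] with t ht
        simpa [hb] using ⟨ht, he⟩
      · have hc : Continuous fun t : ℝ ↦ b x e + t * q e := by fun_prop
        exact (hc.continuousAt.eventually_ne (by simpa using hb)).filter_mono nhdsWithin_le_nhds
    filter_upwards [hne, self_mem_nhdsWithin] with t ht ht0
    refine h _ ?_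
    have : q (x + t • e) = t * (b x e + t * q e) := by rw [hq, hx]; ring
    rw [this]
    exact mul_ne_zero ht0 ht
  have h2 : Filter.Tendsto (fun t : ℝ ↦ f (x + t • e)) (𝓝[≠] 0) (𝓝 (f (x + (0 : ℝ) • e))) :=
    ((hf x e).tendsto 0).mono_left nhdsWithin_le_nhds
  have h3 : Filter.Tendsto (fun t : ℝ ↦ f (x + t • e)) (𝓝[≠] 0) (𝓝 0) :=
    tendsto_const_nhds.congr' (h1.mono fun t ht ↦ ht.symm)
  simpa using tendsto_nhds_unique h2 h3

/-- An algebraic curvature tensor with the symmetries of a paraSasakian curvature tensor whose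
paraholomorphic sectional curvature is `k` has the explicit form of constant paraholomorphic
sectional curvature `k`. -/
theorem eq_paraCurvatureForm {R : V → V → V → V → ℝ} (h : IsAlgCurvature R)
    (hξ : ∀ x y z, R x y z ξ = -(g z y * η x - g z x * η y))
    (hφ : ∀ x y z w, R x y (φ z) w + R x y z (φ w) =
      g y z * g (φ x) w - g x z * g (φ y) w - g (φ x) z * g y w + g (φ y) z * g x w)
    {k : ℝ} (hk : ∀ x, g (φ x) (φ x) ≠ 0 →
      R (φ x) (φ (φ x)) (φ (φ x)) (φ x) = -k * g (φ x) (φ x) ^ 2)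
    {e : V} (he : g (φ e) (φ e) ≠ 0) (x y z w : V) :
    R x y z w = paraCurvatureForm g φ η k x y z w := by
  have cont : ∀ {T : V → V → V → V → ℝ}, IsAlgCurvature T → ∀ u v : V, Continuous fun t : ℝ ↦
      T (φ (u + t • v)) (φ (φ (u + t • v))) (φ (φ (u + t • v))) (φ (u + t • v)) := by
    intro T hT u v
    simp only [P.φ_add, P.φ_smul, hT.add_left, hT.add_two, hT.add_three, hT.add_four, hT.smul_left,
      hT.smul_two, hT.smul_three, hT.smul_four]
    fun_prop
  have hD := h.sub (P.isAlgCurvature_form k)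
  refine sub_eq_zero.1 (P.eq_zero_of_paraholomorphic hD (fun x y z ↦ ?_) (fun x y z w ↦ ?_)
    (fun u ↦ ?_) x y z w)
  · rw [hξ, P.form_ξ, sub_self]
  · have := hφ x y z w
    have := P.form_φ k x y z w
    linarith
  · refine eq_zero_of_quadratic_ne_zero (q := fun u ↦ g (φ u) (φ u))
      (b := fun u v ↦ 2 * g (φ u) (φ v))
      (f := fun u ↦ R (φ u) (φ (φ u)) (φ (φ u)) (φ u) -
        paraCurvatureForm g φ η k (φ u) (φ (φ u)) (φ (φ u)) (φ u)) (fun u v ↦ ?_)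
      (fun u v t ↦ ?_) (fun u hu ↦ ?_) he u
    · exact (cont h u v).sub (cont (P.isAlgCurvature_form k) u v)
    · simp only [P.φ_add, P.φ_smul, P.g_add, P.g_smul, P.g_add_right, P.g_smul_right]
      rw [P.g_symm (φ v) (φ u)]
      ring
    · simp only [hk u hu, P.form_diag, sub_self]

end IsParacontact

end ParacontactAlgebra

/-! ### Covariant derivatives of the structure tensors -/

section CovariantDerivativePhiAlgebra

variable {V : Type*} [AddCommGroup V] [Module ℝ V]

namespace IsParacontact

variable {g : V → V → ℝ} {φ : V → V} {ξ : V} {η : V → ℝ} (P : IsParacontact g φ ξ η)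
include P

/-- The algebra computing `∇ξ` and `∇φ`, where `σ x y` stands for `g(∇_x ξ, y)` and `T x y z` for
`g((∇_x φ)y, z)`. The hypotheses are, besides linearity in `x`, the skew-symmetry of `∇_x φ`,
`dΦ = 0`, normality, `(∇_x φ)ξ = -φ(∇_x ξ)`, `dη = Φ`, and `g(ξ, ξ) = 1`. -/
theorem covariantDerivative_identities {T : V → V → V → ℝ} {σ : V → V → ℝ}
    (T_add : ∀ x x' y z, T (x + x') y z = T x y z + T x' y z)
    (T_smul : ∀ (c : ℝ) x y z, T (c • x) y z = c * T x y z)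
    (σ_add : ∀ x x' y, σ (x + x') y = σ x y + σ x' y)
    (σ_smul : ∀ (c : ℝ) x y, σ (c • x) y = c * σ x y)
    (T_swap : ∀ x y z, T x y z = -T x z y)
    (T_cyc : ∀ x y z, T x y z + T y z x + T z x y = 0)
    (T_nijenhuis : ∀ x y z, T (φ x) y z - T (φ y) x z - T y x (φ z) + T x y (φ z)
      = 2 * g x (φ y) * η z)
    (T_ξ : ∀ x z, T x ξ z = σ x (φ z))
    (σ_alt : ∀ x y, σ x y - σ y x = 2 * g x (φ y))
    (σ_ξ : ∀ x, σ x ξ = 0) :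
    (∀ x y, σ x y = g x (φ y)) ∧ ∀ x y z, T x y z = -g x y * η z + η y * g x z := by
  have ξ_σ : ∀ y, σ ξ y = 0 := by
    intro y
    have := σ_alt ξ y
    rw [σ_ξ, P.ξ_g, P.η_φ] at this
    linarith
  have T_zero : ∀ y z, T 0 y z = 0 := by
    intro y z
    have := T_smul 0 0 y z
    simpa using this
  have ξ_T : ∀ y z, T ξ y z = σ y (φ z) - σ z (φ y) := by
    intro y z
    have h1 := T_cyc ξ y z
    have h2 := T_swap y z ξ
    rw [T_ξ] at h1 h2
    linarith
  have σφφ : ∀ x z, σ (φ x) (φ z) = g (φ x) (φ (φ z)) := by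
    intro x z
    have h1 := T_nijenhuis x ξ z
    rw [P.φ_ξ, T_zero, T_ξ, T_ξ, ξ_T, P.g_zero_right] at h1
    have h2 := σ_alt (φ x) (φ z)
    linarith
  have σ_left : ∀ x y, σ (φ (φ x)) y = σ x y := by
    intro x y
    have h1 := σ_add (φ (φ x)) (η x • ξ) y
    rw [P.φ_φ, sub_add_cancel, σ_smul, ξ_σ] at h1
    rw [P.φ_φ, h1]; ring
  have σ_right : ∀ x y, σ x (φ (φ y)) = σ x y := by
    intro x y
    have h1 := σ_alt x (φ (φ y))
    have h2 := σ_alt x y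
    rw [σ_left, P.φ_φ_φ] at h1
    linarith
  have hσ : ∀ x y, σ x y = g x (φ y) := by
    intro x y
    rw [← σ_left, ← σ_right, σφφ, P.φ_φ_φ, P.φ_φ, P.g_sub, P.g_smul, P.ξ_g, P.η_φ]
    ring
  refine ⟨hσ, ?_⟩
  -- the difference `T'` of the two sides has the same symmetries, with zero right-hand sides;
  -- normality and the cyclic identity force `T' (φ x) = 0`, and `T' ξ = 0` by the formula for `ξ_T`
  set T' : V → V → V → ℝ := fun x y z ↦ T x y z + g x y * η z - η y * g x z with hT'
  have swap' : ∀ x y z, T' x y z = -T' x z y := by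
    intro x y z
    simp only [hT']
    linarith [T_swap x y z]
  have cyc' : ∀ x y z, T' x y z + T' y z x + T' z x y = 0 := by
    intro x y z
    simp only [hT']
    rw [P.g_symm z x, P.g_symm z y, P.g_symm y x]
    linarith [T_cyc x y z]
  have nij' : ∀ x y z, T' (φ x) y z - T' (φ y) x z - T' y x (φ z) + T' x y (φ z) = 0 := by
    intro x y z
    simp only [hT', P.η_φ, P.g_φ_left]
    rw [P.g_φ_comm y x]
    linear_combination T_nijenhuis x y z
  have ξ_T' : ∀ y z, T' ξ y z = 0 := by
    intro y z
    simp only [hT', ξ_T, hσ, P.ξ_g, P.φ_φ, P.g_sub_right, P.g_smul_right, P.g_ξ]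
    rw [P.g_symm z y]
    ring
  have a : ∀ x y z, T' (φ x) y z + T' (φ y) z x - T' (φ z) x y = 0 := by
    intro x y z
    linarith [nij' x y z, cyc' y x (φ z), swap' x (φ z) y, swap' (φ z) x y, swap' (φ y) z x]
  have b : ∀ x y z, T' (φ x) y z = 0 := by
    intro x y z
    linarith [a x y z, a z x y]
  intro x y z
  have c : T' x y z = 0 := by
    have h1 : T' (φ (φ x) + η x • ξ) y z = T' (φ (φ x)) y z + η x * T' ξ y z := by
      simp only [hT', T_add, T_smul, P.g_add, P.g_smul]
      ring
    rw [b, ξ_T', P.φ_φ, sub_add_cancel] at h1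
    linarith
  simp only [hT'] at c
  linarith

end IsParacontact

end CovariantDerivativePhiAlgebra

section ParacontactGeometry
open Filter

variable {n : ℕ} {M : Type*} [TopologicalSpace M]
  [ChartedSpace (EuclideanSpace ℝ (Fin (2 * n + 1))) M] [IsManifold (𝓡 (2 * n + 1)) ∞ M]

namespace ParacontactMetricStructure

variable (S : ParacontactMetricStructure n M)
variable {X X' Y Y' Z : Π q : M, TangentSpace (𝓡 (2 * n + 1)) q} {f : M → ℝ} {p : M}

theorem isParacontact (p : M) : IsParacontact (fun u v ↦ S.g.inner p u v) (fun v ↦ S.φ p v)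
    (S.ξ p) (fun v ↦ S.η p v) where
  g_add x x' y := by rw [map_add, add_apply]
  g_smul c x y := by rw [map_smul, smul_apply, smul_eq_mul]
  g_symm x y := S.g.symm p x y
  g_ext x y h := S.g.eq_of_inner_eq h
  φ_add x y := map_add _ _ _
  φ_smul c x := map_smul _ _ _
  η_add x y := map_add _ _ _
  η_smul c x := map_smul _ _ _
  φ_ξ := S.φ_ξ p
  η_φ := S.η_φ p
  η_ξ := S.η_ξ p
  φ_φ := S.φ_φ p
  g_φ_φ := S.inner_φ_φ p

theorem inner_φ_left (p : M) (u v : TangentSpace (𝓡 (2 * n + 1)) p) :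
    S.g.inner p (S.φ p u) v = -S.g.inner p u (S.φ p v) :=
  (S.isParacontact p).g_φ_left u v

theorem inner_ξ (p : M) (u : TangentSpace (𝓡 (2 * n + 1)) p) :
    S.g.inner p u (S.ξ p) = S.η p u :=
  (S.isParacontact p).g_ξ u

theorem ξ_inner (p : M) (u : TangentSpace (𝓡 (2 * n + 1)) p) :
    S.g.inner p (S.ξ p) u = S.η p u :=
  (S.isParacontact p).ξ_g u

/-- The vector field `φX`. -/
def phiField (X : Π q : M, TangentSpace (𝓡 (2 * n + 1)) q) (q : M) : TangentSpace (𝓡 (2 * n + 1)) q :=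
  S.φ q (X q)

theorem contMDiffAt_phiField (hX : ContMDiffAt (𝓡 (2 * n + 1)) (𝓡 (2 * n + 1)).tangent ∞ (T% X) p) :
    ContMDiffAt (𝓡 (2 * n + 1)) (𝓡 (2 * n + 1)).tangent ∞ (T% (S.phiField X)) p :=
  ContMDiffAt.clm_bundle_apply (F₁ := EuclideanSpace ℝ (Fin (2 * n + 1)))
      (F₂ := EuclideanSpace ℝ (Fin (2 * n + 1))) (S.contMDiff_φ p) hX

theorem contMDiffAt_eta (hX : ContMDiffAt (𝓡 (2 * n + 1)) (𝓡 (2 * n + 1)).tangent ∞ (T% X) p) :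
    ContMDiffAt (𝓡 (2 * n + 1)) 𝓘(ℝ, ℝ) ∞ (fun q ↦ S.η q (X q)) p := by
  have := S.g.contMDiffAt_inner hX (S.contMDiff_ξ p)
  simpa only [S.inner_ξ] using this

/-- The vector `(∇_X φ) Y`. -/
def nablaPhi (X Y : Π q : M, TangentSpace (𝓡 (2 * n + 1)) q) (p : M) : TangentSpace (𝓡 (2 * n + 1)) p :=
  S.g.leviCivita X (S.phiField Y) p - S.φ p (S.g.leviCivita X Y p)

/-- The vector `(∇_X φ) Y` at `p` depends only on the values of the smooth fields `X`, `Y` at `p`. -/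
theorem nablaPhi_pointwise
    (hX : ContMDiffAt (𝓡 (2 * n + 1)) (𝓡 (2 * n + 1)).tangent ∞ (T% X) p)
    (hX' : ContMDiffAt (𝓡 (2 * n + 1)) (𝓡 (2 * n + 1)).tangent ∞ (T% X') p)
    (hY : ContMDiffAt (𝓡 (2 * n + 1)) (𝓡 (2 * n + 1)).tangent ∞ (T% Y) p)
    (hY' : ContMDiffAt (𝓡 (2 * n + 1)) (𝓡 (2 * n + 1)).tangent ∞ (T% Y') p)
    (h : X p = X' p) (h' : Y p = Y' p) : S.nablaPhi X Y p = S.nablaPhi X' Y' p := by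
  have e1 : S.nablaPhi X Y p = S.nablaPhi X' Y p := by
    rw [nablaPhi, nablaPhi, S.g.leviCivita_congr_left hX.mdiff_infty hX'.mdiff_infty hY.mdiff_infty h,
      S.g.leviCivita_congr_left hX.mdiff_infty hX'.mdiff_infty (S.contMDiffAt_phiField hY).mdiff_infty h]
  rw [e1]
  refine eq_of_smooth_tensorial (fun Y ↦ S.nablaPhi X' Y p) (fun Y Y' h ↦ ?_) (fun Y Y' h h' ↦ ?_)
    (fun f Y hf h ↦ ?_) hY hY' h'
  · have e : S.phiField Y =ᶠ[𝓝 p] S.phiField Y' := h.mono fun q hq ↦ by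
      simp only [phiField, hq]
      rfl
    simp only [nablaPhi]
    rw [S.g.leviCivita_congr_right _ h, S.g.leviCivita_congr_right _ e]
  · have e : S.phiField (Y + Y') = S.phiField Y + S.phiField Y' := by
      ext1 q; simp only [phiField, Pi.add_apply, map_add]
    simp only [nablaPhi]
    rw [e, S.g.leviCivita_add_right hX'.mdiff_infty h.mdiff_infty h'.mdiff_infty,
      S.g.leviCivita_add_right hX'.mdiff_infty (S.contMDiffAt_phiField h).mdiff_infty
        (S.contMDiffAt_phiField h').mdiff_infty, map_add]
    abel
  · have e : S.phiField (f • Y) = f • S.phiField Y := by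
      ext1 q; simp only [phiField, Pi.smul_apply', map_smul]
    have hf' : MDifferentiableAt (𝓡 (2 * n + 1)) 𝓘(ℝ, ℝ) f p := hf.mdifferentiableAt (by simp)
    simp only [nablaPhi]
    rw [e, S.g.leviCivita_smul_right hf' hX'.mdiff_infty h.mdiff_infty,
      S.g.leviCivita_smul_right hf' hX'.mdiff_infty (S.contMDiffAt_phiField h).mdiff_infty, map_add,
      map_smul, map_smul]
    simp only [phiField]
    module

theorem contMDiffAt_xi : ContMDiffAt (𝓡 (2 * n + 1)) (𝓡 (2 * n + 1)).tangent ∞ (T% S.ξ) p :=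
  S.contMDiff_ξ p

/-- The endomorphism `∇_X φ` is skew-symmetric, as `φ` is. -/
theorem inner_nablaPhi_swap
    (hX : ContMDiffAt (𝓡 (2 * n + 1)) (𝓡 (2 * n + 1)).tangent ∞ (T% X) p)
    (hY : ContMDiffAt (𝓡 (2 * n + 1)) (𝓡 (2 * n + 1)).tangent ∞ (T% Y) p)
    (hZ : ContMDiffAt (𝓡 (2 * n + 1)) (𝓡 (2 * n + 1)).tangent ∞ (T% Z) p) :
    S.g.inner p (S.nablaPhi X Y p) (Z p) = -S.g.inner p (S.nablaPhi X Z p) (Y p) := by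
  have h1 := S.g.mvfderiv_inner hX.mdiff_infty (S.contMDiffAt_phiField hY).mdiff_infty hZ.mdiff_infty
  have h2 := S.g.mvfderiv_inner hX.mdiff_infty hY.mdiff_infty (S.contMDiffAt_phiField hZ).mdiff_infty
  have e : (fun q : M ↦ S.g.inner q (S.phiField Y q) (Z q)) =
      -fun q ↦ S.g.inner q (Y q) (S.phiField Z q) := by
    ext1 q; exact S.inner_φ_left q _ _
  rw [e, mvfderiv_neg, neg_apply, h2] at h1
  simp only [nablaPhi, map_sub, sub_apply, S.inner_φ_left]
  rw [S.g.symm p _ (Y p)]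
  have h4 : S.g.inner p (S.g.leviCivita X Z p) (S.φ p (Y p)) = S.g.inner p (S.phiField Y p) (S.g.leviCivita X Z p) :=
    S.g.symm p _ _
  have h5 : S.phiField Z p = S.φ p (Z p) := rfl
  rw [h5] at h1
  rw [h4]
  linarith

theorem mvfderiv_eta
    (hX : ContMDiffAt (𝓡 (2 * n + 1)) (𝓡 (2 * n + 1)).tangent ∞ (T% X) p)
    (hY : ContMDiffAt (𝓡 (2 * n + 1)) (𝓡 (2 * n + 1)).tangent ∞ (T% Y) p) :
    mvfderiv (𝓡 (2 * n + 1)) (fun q ↦ S.η q (Y q)) p (X p) =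
      S.g.inner p (S.g.leviCivita X S.ξ p) (Y p) + S.η p (S.g.leviCivita X Y p) := by
  have h := S.g.mvfderiv_inner hX.mdiff_infty S.contMDiffAt_xi.mdiff_infty hY.mdiff_infty
  simpa only [S.ξ_inner] using h

theorem inner_nabla_xi_xi
    (hX : ContMDiffAt (𝓡 (2 * n + 1)) (𝓡 (2 * n + 1)).tangent ∞ (T% X) p) :
    S.g.inner p (S.g.leviCivita X S.ξ p) (S.ξ p) = 0 := by
  have h := S.mvfderiv_eta hX S.contMDiffAt_xi
  simp only [S.η_ξ, mvfderiv_const, zero_apply] at h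
  rw [S.inner_ξ] at h ⊢
  linarith

theorem nablaPhi_xi
    (hX : ContMDiffAt (𝓡 (2 * n + 1)) (𝓡 (2 * n + 1)).tangent ∞ (T% X) p) :
    S.nablaPhi X S.ξ p = -S.φ p (S.g.leviCivita X S.ξ p) := by
  have e : S.phiField S.ξ = 0 := by
    ext1 q; exact S.φ_ξ q
  rw [nablaPhi, e, S.g.leviCivita_zero_right hX.mdiff_infty, zero_sub]

/-- The brackets in the Nijenhuis tensor, expressed by the torsion-free connection. -/
theorem nijenhuis_eq_nablaPhi
    (hX : ContMDiffAt (𝓡 (2 * n + 1)) (𝓡 (2 * n + 1)).tangent ∞ (T% X) p)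
    (hY : ContMDiffAt (𝓡 (2 * n + 1)) (𝓡 (2 * n + 1)).tangent ∞ (T% Y) p) :
    nijenhuis S.φ X Y p = S.nablaPhi (S.phiField X) Y p - S.nablaPhi (S.phiField Y) X p
      + S.φ p (S.nablaPhi Y X p) - S.φ p (S.nablaPhi X Y p) := by
  have hφX := (S.contMDiffAt_phiField hX).mdiff_infty
  have hφY := (S.contMDiffAt_phiField hY).mdiff_infty
  change mlieBracket (𝓡 (2 * n + 1)) (S.phiField X) (S.phiField Y) p
    - S.φ p (mlieBracket (𝓡 (2 * n + 1)) (S.phiField X) Y p)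
    - S.φ p (mlieBracket (𝓡 (2 * n + 1)) X (S.phiField Y) p)
    + S.φ p (S.φ p (mlieBracket (𝓡 (2 * n + 1)) X Y p)) = _
  rw [← S.g.leviCivita_sub_swap hφX hφY, ← S.g.leviCivita_sub_swap hφX hY.mdiff_infty,
    ← S.g.leviCivita_sub_swap hX.mdiff_infty hφY, ← S.g.leviCivita_sub_swap hX.mdiff_infty hY.mdiff_infty]
  simp only [nablaPhi, map_sub]
  abel

/-- The identity `dη = Φ` in terms of `∇ξ`. -/
theorem nabla_xi_alt
    (hX : ContMDiffAt (𝓡 (2 * n + 1)) (𝓡 (2 * n + 1)).tangent ∞ (T% X) p)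
    (hY : ContMDiffAt (𝓡 (2 * n + 1)) (𝓡 (2 * n + 1)).tangent ∞ (T% Y) p) :
    S.g.inner p (S.g.leviCivita X S.ξ p) (Y p) - S.g.inner p (S.g.leviCivita Y S.ξ p) (X p) =
      2 * S.g.inner p (X p) (S.φ p (Y p)) := by
  rw [S.inner_φ p X Y hX hY, halfExtDeriv, S.mvfderiv_eta hX hY, S.mvfderiv_eta hY hX,
    ← S.g.leviCivita_sub_swap hX.mdiff_infty hY.mdiff_infty, map_sub]
  ring

/-- The identity `dΦ = 0` in terms of `∇φ`; it holds because `Φ = dη`. -/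
theorem nablaPhi_cyc (x y z : TangentSpace (𝓡 (2 * n + 1)) p) :
    S.g.inner p (S.nablaPhi (coordField x) (coordField y) p) z
      + S.g.inner p (S.nablaPhi (coordField y) (coordField z) p) x
      + S.g.inner p (S.nablaPhi (coordField z) (coordField x) p) y = 0 := by
  have hs := fun v : TangentSpace (𝓡 (2 * n + 1)) p ↦ contMDiffAt_coordField v
  have hv := fun v : TangentSpace (𝓡 (2 * n + 1)) p ↦ coordField_self v
  have hc := fun v w : TangentSpace (𝓡 (2 * n + 1)) p ↦ mlieBracket_coordField v w
  -- the derivative of `Φ(Y, Z)` along `X` is computed from `Φ = dη`, and from the connection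
  have d1 : ∀ x y z : TangentSpace (𝓡 (2 * n + 1)) p,
      mvfderiv (𝓡 (2 * n + 1)) (fun q ↦ S.g.inner q (coordField y q) (S.phiField (coordField z) q)) p x =
      1 / 2 * (mvfderiv (𝓡 (2 * n + 1)) (fun q ↦ mvfderiv (𝓡 (2 * n + 1))
          (fun q ↦ S.η q (coordField z q)) q (coordField y q)) p x -
        mvfderiv (𝓡 (2 * n + 1)) (fun q ↦ mvfderiv (𝓡 (2 * n + 1))
          (fun q ↦ S.η q (coordField y q)) q (coordField z q)) p x) := by
    intro x y z
    have e : (fun q ↦ S.g.inner q (coordField y q) (S.phiField (coordField z) q)) =ᶠ[𝓝 p]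
        fun q ↦ (1 / 2 : ℝ) * (mvfderiv (𝓡 (2 * n + 1)) (fun q ↦ S.η q (coordField z q)) q (coordField y q)
          - mvfderiv (𝓡 (2 * n + 1)) (fun q ↦ S.η q (coordField y q)) q (coordField z q)) := by
      filter_upwards [eventually_contMDiffAt_coordField y, eventually_contMDiffAt_coordField z, hc y z] with q h1 h2 h3
      change S.g.inner q (coordField y q) (S.φ q (coordField z q)) = _
      rw [S.inner_φ q _ _ h1 h2, halfExtDeriv, h3, map_zero, sub_zero]
    have h1 := (contMDiffAt_mvfderiv_apply (hs y) (S.contMDiffAt_eta (hs z))).mdifferentiableAt (by simp)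
    have h2 := (contMDiffAt_mvfderiv_apply (hs z) (S.contMDiffAt_eta (hs y))).mdifferentiableAt (by simp)
    have h3 : MDifferentiableAt (𝓡 (2 * n + 1)) 𝓘(ℝ, ℝ) (fun q ↦
        mvfderiv (𝓡 (2 * n + 1)) (fun q ↦ S.η q (coordField z q)) q (coordField y q)
          - mvfderiv (𝓡 (2 * n + 1)) (fun q ↦ S.η q (coordField y q)) q (coordField z q)) p := h1.sub h2
    rw [mvfderiv_congr_of_eventuallyEq e, mvfderiv_fun_mul mdifferentiableAt_const h3,
      mvfderiv_const, mvfderiv_fun_sub h1 h2]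
    simp only [add_apply, sub_apply, smul_apply, zero_apply, smul_eq_mul, mul_zero, add_zero]
  have d2 : ∀ x y z : TangentSpace (𝓡 (2 * n + 1)) p,
      mvfderiv (𝓡 (2 * n + 1)) (fun q ↦ S.g.inner q (coordField y q) (S.phiField (coordField z) q)) p x =
      S.g.inner p (S.g.leviCivita (coordField x) (coordField y) p) (S.φ p z)
      - S.g.inner p (S.g.leviCivita (coordField x) (coordField z) p) (S.φ p y)
      + S.g.inner p (S.nablaPhi (coordField x) (coordField z) p) y := by
    intro x y z
    have h := S.g.mvfderiv_inner (hs x).mdiff_infty (hs y).mdiff_infty (S.contMDiffAt_phiField (hs z)).mdiff_infty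
    rw [hv, hv] at h
    rw [h, nablaPhi, map_sub, sub_apply, S.inner_φ_left, phiField, hv, S.g.symm p y]
    ring
  have comm : ∀ x y z : TangentSpace (𝓡 (2 * n + 1)) p,
      mvfderiv (𝓡 (2 * n + 1)) (fun q ↦ mvfderiv (𝓡 (2 * n + 1))
          (fun q ↦ S.η q (coordField z q)) q (coordField y q)) p x =
      mvfderiv (𝓡 (2 * n + 1)) (fun q ↦ mvfderiv (𝓡 (2 * n + 1))
          (fun q ↦ S.η q (coordField z q)) q (coordField x q)) p y := by
    intro x y z
    have h := mvfderiv_mlieBracket (hs x) (hs y) (S.contMDiffAt_eta (hs z))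
    rw [(hc x y).self_of_nhds, map_zero, hv, hv] at h
    linarith
  have sw : ∀ x y : TangentSpace (𝓡 (2 * n + 1)) p,
      S.g.leviCivita (coordField x) (coordField y) p = S.g.leviCivita (coordField y) (coordField x) p :=
    fun x y ↦ (S.g.leviCivita_comm_of_commute (hs x) (hs y) (hc x y)).self_of_nhds
  have i1 := (d1 x y z).symm.trans (d2 x y z)
  have i2 := (d1 y z x).symm.trans (d2 y z x)
  have i3 := (d1 z x y).symm.trans (d2 z x y)
  have c1 := comm x y z
  have c2 := comm y z x
  have c3 := comm z x y
  rw [sw y x, sw z x, sw z y] at *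
  have s1 := S.inner_nablaPhi_swap (hs x) (hs y) (hs z)
  have s2 := S.inner_nablaPhi_swap (hs y) (hs z) (hs x)
  have s3 := S.inner_nablaPhi_swap (hs z) (hs x) (hs y)
  rw [hv, hv] at s1 s2 s3
  linarith

variable {S} in
/-- The covariant derivatives of `ξ` and `φ` on a paraSasakian manifold, at a point. -/
theorem IsParaSasakian.covariantDerivative_aux (hS : S.IsParaSasakian) (p : M) :
    (∀ x y : TangentSpace (𝓡 (2 * n + 1)) p,
      S.g.inner p (S.g.leviCivita (coordField x) S.ξ p) y = S.g.inner p x (S.φ p y)) ∧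
    ∀ x y z : TangentSpace (𝓡 (2 * n + 1)) p,
      S.g.inner p (S.nablaPhi (coordField x) (coordField y) p) z =
        -S.g.inner p x y * S.η p z + S.η p y * S.g.inner p x z := by
  have hs := fun v : TangentSpace (𝓡 (2 * n + 1)) p ↦ contMDiffAt_coordField v
  have hv := fun v : TangentSpace (𝓡 (2 * n + 1)) p ↦ coordField_self v
  have hmul : ∀ (c : ℝ) (x : TangentSpace (𝓡 (2 * n + 1)) p),
      ContMDiffAt (𝓡 (2 * n + 1)) (𝓡 (2 * n + 1)).tangent ∞ (T% ((fun _ : M ↦ c) • coordField x)) p :=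
    fun c x ↦ ContMDiffAt.smul_section contMDiffAt_const (hs x)
  have hxi := (S.contMDiffAt_xi (p := p)).mdiff_infty
  -- additivity in the direction of differentiation
  have nab_add : ∀ (x x' : TangentSpace (𝓡 (2 * n + 1)) p) {Y : Π q : M, TangentSpace (𝓡 (2 * n + 1)) q},
      MDifferentiableAt (𝓡 (2 * n + 1)) (𝓡 (2 * n + 1)).tangent (T% Y) p →
      S.g.leviCivita (coordField (x + x')) Y p =
        S.g.leviCivita (coordField x) Y p + S.g.leviCivita (coordField x') Y p := by
    intro x x' Y hY
    rw [← S.g.leviCivita_add_left (hs x).mdiff_infty (hs x').mdiff_infty hY]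
    refine S.g.leviCivita_congr_left (hs _).mdiff_infty ((hs x).add_section (hs x')).mdiff_infty hY ?_
    rw [Pi.add_apply, hv, hv, hv]
  have nab_smul : ∀ (c : ℝ) (x : TangentSpace (𝓡 (2 * n + 1)) p) {Y : Π q : M, TangentSpace (𝓡 (2 * n + 1)) q},
      MDifferentiableAt (𝓡 (2 * n + 1)) (𝓡 (2 * n + 1)).tangent (T% Y) p →
      S.g.leviCivita (coordField (c • x)) Y p = c • S.g.leviCivita (coordField x) Y p := by
    intro c x Y hY
    rw [← S.g.leviCivita_smul_left (f := fun _ ↦ c) mdifferentiableAt_const (hs x).mdiff_infty hY]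
    refine S.g.leviCivita_congr_left (hs _).mdiff_infty (hmul c x).mdiff_infty hY ?_
    rw [Pi.smul_apply', hv, hv]
  refine (S.isParacontact p).covariantDerivative_identities
    (T := fun x y z ↦ S.g.inner p (S.nablaPhi (coordField x) (coordField y) p) z)
    (σ := fun x y ↦ S.g.inner p (S.g.leviCivita (coordField x) S.ξ p) y)
    (fun x x' y z ↦ ?_) (fun c x y z ↦ ?_) (fun x x' y ↦ ?_) (fun c x y ↦ ?_) (fun x y z ↦ ?_)
    (S.nablaPhi_cyc) (fun x y z ↦ ?_) (fun x z ↦ ?_) (fun x y ↦ ?_) (fun x ↦ ?_)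
  · rw [nablaPhi, nab_add x x' (S.contMDiffAt_phiField (hs y)).mdiff_infty,
      nab_add x x' (hs y).mdiff_infty, nablaPhi, nablaPhi]
    simp only [map_add, map_sub, add_apply, sub_apply]
    ring
  · rw [nablaPhi, nab_smul c x (S.contMDiffAt_phiField (hs y)).mdiff_infty,
      nab_smul c x (hs y).mdiff_infty, nablaPhi]
    simp only [map_smul, map_sub, smul_apply, sub_apply, smul_eq_mul]
    ring
  · rw [nab_add x x' hxi, map_add, add_apply]
  · rw [nab_smul c x hxi, map_smul, smul_apply, smul_eq_mul]
  · have h := S.inner_nablaPhi_swap (hs x) (hs y) (hs z)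
    rwa [hv, hv] at h
  · have h := hS p _ _ (hs x) (hs y)
    rw [S.nijenhuis_eq_nablaPhi (hs x) (hs y), ← S.inner_φ p _ _ (hs x) (hs y), hv, hv] at h
    have e1 : ∀ x y : TangentSpace (𝓡 (2 * n + 1)) p, S.nablaPhi (S.phiField (coordField x)) (coordField y) p =
        S.nablaPhi (coordField (S.φ p x)) (coordField y) p := by
      intro x y
      refine S.nablaPhi_pointwise (S.contMDiffAt_phiField (hs x)) (hs _) (hs y) (hs y) ?_ rfl
      rw [phiField, hv, hv]
    rw [e1, e1] at h
    have h' := congrArg (fun v ↦ S.g.inner p v z) h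
    simp only [map_add, map_sub, add_apply, sub_apply, map_smul, smul_apply, smul_eq_mul,
      S.inner_φ_left, S.ξ_inner] at h'
    linarith
  · have h := S.nablaPhi_xi (hs x)
    rw [S.nablaPhi_pointwise (hs x) (hs x) S.contMDiffAt_xi (hs (S.ξ p)) rfl (hv _).symm] at h
    rw [h, map_neg, neg_apply, S.inner_φ_left, neg_neg]
  · have h := S.nabla_xi_alt (hs x) (hs y)
    rwa [hv, hv] at h
  · exact S.inner_nabla_xi_xi (hs x)

variable {S} in
theorem IsParaSasakian.nabla_xi (hS : S.IsParaSasakian)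
    (hX : ContMDiffAt (𝓡 (2 * n + 1)) (𝓡 (2 * n + 1)).tangent ∞ (T% X) p) :
    S.g.leviCivita X S.ξ p = -S.φ p (X p) := by
  refine S.g.eq_of_inner_eq fun w ↦ ?_
  rw [S.g.leviCivita_congr_left hX.mdiff_infty (contMDiffAt_coordField (X p)).mdiff_infty
    S.contMDiffAt_xi.mdiff_infty (coordField_self _).symm, (hS.covariantDerivative_aux p).1,
    map_neg, neg_apply, S.inner_φ_left, neg_neg]

variable {S} in
theorem IsParaSasakian.nabla_phi (hS : S.IsParaSasakian)
    (hX : ContMDiffAt (𝓡 (2 * n + 1)) (𝓡 (2 * n + 1)).tangent ∞ (T% X) p)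
    (hY : ContMDiffAt (𝓡 (2 * n + 1)) (𝓡 (2 * n + 1)).tangent ∞ (T% Y) p) :
    S.g.leviCivita X (S.phiField Y) p =
      S.φ p (S.g.leviCivita X Y p) - S.g.inner p (X p) (Y p) • S.ξ p + S.η p (Y p) • X p := by
  have h : S.nablaPhi X Y p = -S.g.inner p (X p) (Y p) • S.ξ p + S.η p (Y p) • X p := by
    refine S.g.eq_of_inner_eq fun w ↦ ?_
    rw [S.nablaPhi_pointwise hX (contMDiffAt_coordField (X p)) hY (contMDiffAt_coordField (Y p))
      (coordField_self _).symm (coordField_self _).symm, (hS.covariantDerivative_aux p).2]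
    simp only [map_add, add_apply, map_smul, smul_apply, smul_eq_mul, S.ξ_inner]
  have h' : S.g.leviCivita X (S.phiField Y) p = S.nablaPhi X Y p + S.φ p (S.g.leviCivita X Y p) := by
    rw [nablaPhi, sub_add_cancel]
  rw [h', h]
  module

end ParacontactMetricStructure

end ParacontactGeometry

/-! ### Curvature of paraSasakian manifolds -/

section ParaSasakianCurvature
open Filter

variable {n : ℕ} {M : Type*} [TopologicalSpace M]
  [ChartedSpace (EuclideanSpace ℝ (Fin (2 * n + 1))) M] [IsManifold (𝓡 (2 * n + 1)) ∞ M]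

namespace ParacontactMetricStructure

variable {S : ParacontactMetricStructure n M}
variable {X Y Z : Π q : M, TangentSpace (𝓡 (2 * n + 1)) q} {p : M}

namespace IsParaSasakian

variable (hS : S.IsParaSasakian)
include hS

theorem mvfderiv_eta
    (hX : ContMDiffAt (𝓡 (2 * n + 1)) (𝓡 (2 * n + 1)).tangent ∞ (T% X) p)
    (hY : ContMDiffAt (𝓡 (2 * n + 1)) (𝓡 (2 * n + 1)).tangent ∞ (T% Y) p) :
    mvfderiv (𝓡 (2 * n + 1)) (fun q ↦ S.η q (Y q)) p (X p) =
      S.g.inner p (X p) (S.φ p (Y p)) + S.η p (S.g.leviCivita X Y p) := by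
  rw [S.mvfderiv_eta hX hY, hS.nabla_xi hX, map_neg, neg_apply, S.inner_φ_left, neg_neg]

/-- The identity `R(x, y)ξ = η(x)y - η(y)x`, in the form of an inner product with `z`. -/
theorem curvature_xi (x y z : TangentSpace (𝓡 (2 * n + 1)) p) :
    S.g.curvature p x y z (S.ξ p) =
      -(S.g.inner p z y * S.η p x - S.g.inner p z x * S.η p y) := by
  have hs := fun v : TangentSpace (𝓡 (2 * n + 1)) p ↦ contMDiffAt_coordField v
  have hv := fun v : TangentSpace (𝓡 (2 * n + 1)) p ↦ coordField_self v
  have hc := mlieBracket_coordField x y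
  have e : ∀ v : TangentSpace (𝓡 (2 * n + 1)) p,
      S.g.leviCivita (coordField v) S.ξ =ᶠ[𝓝 p] -S.phiField (coordField v) := by
    intro v
    filter_upwards [eventually_contMDiffAt_coordField v] with q hq
    exact hS.nabla_xi hq
  have h := S.g.curvature_eq (hs x) (hs y) S.contMDiffAt_xi z
  have e1 : ∀ u v : TangentSpace (𝓡 (2 * n + 1)) p,
      S.g.leviCivita (coordField u) (S.g.leviCivita (coordField v) S.ξ) p =
      -(S.φ p (S.g.leviCivita (coordField u) (coordField v) p) - S.g.inner p u v • S.ξ p + S.η p v • u) := by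
    intro u v
    rw [S.g.leviCivita_congr_right _ (e v), S.g.leviCivita_neg_right (hs u).mdiff_infty
      (S.contMDiffAt_phiField (hs v)).mdiff_infty, hS.nabla_phi (hs u) (hs v), hv, hv]
  rw [hv, hv, S.g.curvatureOperator_of_commute S.contMDiffAt_xi hc, e1, e1,
    (S.g.leviCivita_comm_of_commute (hs x) (hs y) hc).self_of_nhds] at h
  rw [(S.g.isAlgCurvature_curvature p).swap_right, h]
  simp only [map_sub, map_add, map_neg, map_smul, sub_apply, add_apply, neg_apply, smul_apply,
    smul_eq_mul]
  rw [S.g.symm p y x, S.g.symm p z x, S.g.symm p z y]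
  ring

/-- The commutator of `R(x, y)` and `φ`. -/
theorem curvature_phi (x y z w : TangentSpace (𝓡 (2 * n + 1)) p) :
    S.g.curvature p x y (S.φ p z) w + S.g.curvature p x y z (S.φ p w) =
      S.g.inner p y z * S.g.inner p (S.φ p x) w - S.g.inner p x z * S.g.inner p (S.φ p y) w
        - S.g.inner p (S.φ p x) z * S.g.inner p y w + S.g.inner p (S.φ p y) z * S.g.inner p x w := by
  have hs := fun v : TangentSpace (𝓡 (2 * n + 1)) p ↦ contMDiffAt_coordField v
  have hv := fun v : TangentSpace (𝓡 (2 * n + 1)) p ↦ coordField_self v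
  have hc := mlieBracket_coordField x y
  have hz := S.contMDiffAt_phiField (hs z)
  have hxi := (S.contMDiffAt_xi (p := p))
  have e : ∀ v : TangentSpace (𝓡 (2 * n + 1)) p,
      S.g.leviCivita (coordField v) (S.phiField (coordField z)) =ᶠ[𝓝 p]
        S.phiField (S.g.leviCivita (coordField v) (coordField z))
          + ((fun q ↦ -S.g.inner q (coordField v q) (coordField z q)) • S.ξ
            + (fun q ↦ S.η q (coordField z q)) • coordField v) := by
    intro v
    filter_upwards [eventually_contMDiffAt_coordField v, eventually_contMDiffAt_coordField z]
      with q h1 h2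
    refine (hS.nabla_phi h1 h2).trans ?_
    simp only [Pi.add_apply, Pi.smul_apply', phiField]
    module
  have e1 : ∀ u v : TangentSpace (𝓡 (2 * n + 1)) p,
      S.g.leviCivita (coordField u) (S.g.leviCivita (coordField v) (S.phiField (coordField z))) p =
      S.φ p (S.g.leviCivita (coordField u) (S.g.leviCivita (coordField v) (coordField z)) p)
      - S.g.inner p u (S.g.leviCivita (coordField v) (coordField z) p) • S.ξ p
      + S.η p (S.g.leviCivita (coordField v) (coordField z) p) • u
      + (-(S.g.inner p (S.g.leviCivita (coordField u) (coordField v) p) z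
          + S.g.inner p v (S.g.leviCivita (coordField u) (coordField z) p)) • S.ξ p
        + S.g.inner p v z • S.φ p u)
      + ((S.g.inner p u (S.φ p z) + S.η p (S.g.leviCivita (coordField u) (coordField z) p)) • v
        + S.η p z • S.g.leviCivita (coordField u) (coordField v) p) := by
    intro u v
    have h1 := S.g.contMDiffAt_leviCivita (hs v) (hs z)
    have h2 := S.g.contMDiffAt_inner (hs v) (hs z)
    have h3 := S.contMDiffAt_eta (hs z)
    have h4 := h2.neg.smul_section hxi
    have h5 := h3.smul_section (hs v)
    have m1 := S.g.mvfderiv_inner (hs u).mdiff_infty (hs v).mdiff_infty (hs z).mdiff_infty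
    have m2 := hS.mvfderiv_eta (hs u) (hs z)
    have m3 : mvfderiv (𝓡 (2 * n + 1)) (fun q ↦ -S.g.inner q (coordField v q) (coordField z q)) p
        (coordField u p) = -mvfderiv (𝓡 (2 * n + 1))
          (fun q ↦ S.g.inner q (coordField v q) (coordField z q)) p (coordField u p) := by
      rw [← neg_apply, ← mvfderiv_neg]
      rfl
    rw [S.g.leviCivita_congr_right _ (e v), S.g.leviCivita_add_right (hs u).mdiff_infty
      (S.contMDiffAt_phiField h1).mdiff_infty (h4.add_section h5).mdiff_infty,
      S.g.leviCivita_add_right (hs u).mdiff_infty h4.mdiff_infty h5.mdiff_infty,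
      S.g.leviCivita_smul_right (h2.neg.mdifferentiableAt (by simp)) (hs u).mdiff_infty hxi.mdiff_infty,
      S.g.leviCivita_smul_right (h3.mdifferentiableAt (by simp)) (hs u).mdiff_infty (hs v).mdiff_infty,
      hS.nabla_phi (hs u) h1, hS.nabla_xi (hs u), m3, m1, m2]
    simp only [hv]
    module
  have h := S.g.curvature_eq (hs x) (hs y) hz w
  have h' := S.g.curvature_eq (hs x) (hs y) (hs z) (S.φ p w)
  rw [hv, hv, S.g.curvatureOperator_of_commute hz hc, e1, e1,
    (S.g.leviCivita_comm_of_commute (hs x) (hs y) hc).self_of_nhds] at h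
  rw [hv, hv, S.g.curvatureOperator_of_commute (hs z) hc] at h'
  rw [hv] at h'
  have hp : S.phiField (coordField z) p = S.φ p z := by rw [phiField, hv]
  rw [hp] at h
  rw [h, h']
  simp only [map_sub, map_add, map_smul, sub_apply, add_apply, smul_apply, smul_eq_mul,
    S.inner_φ_left, S.ξ_inner]
  ring

end IsParaSasakian

/-- The section `v` has paraholomorphic curvature `k` exactly when the curvature tensor takes the
value `-k g(φv, φv)²` on it, since `g(φ²v, φ²v) = -g(φv, φv)`. -/
theorem curvature_section {v : TangentSpace (𝓡 (2 * n + 1)) p} (hv : S.DeterminesSection p v) :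
    S.g.curvature p (S.φ p v) (S.φ p (S.φ p v)) (S.φ p (S.φ p v)) (S.φ p v) =
      -S.paraholomorphicCurvature p v * S.g.inner p (S.φ p v) (S.φ p v) ^ 2 := by
  have hd : S.g.inner p (S.φ p v) (S.φ p v) * S.g.inner p (S.φ p (S.φ p v)) (S.φ p (S.φ p v))
      - S.g.inner p (S.φ p v) (S.φ p (S.φ p v)) ^ 2 = -S.g.inner p (S.φ p v) (S.φ p v) ^ 2 := by
    rw [S.inner_φ_φ p (S.φ p v), S.η_φ, (S.isParacontact p).g_φ_self]
    ring
  rw [paraholomorphicCurvature, PseudoRiemannianMetric.sectionalCurvature, hd]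
  have h : S.g.inner p (S.φ p v) (S.φ p v) ^ 2 ≠ 0 := pow_ne_zero 2 hv
  rw [div_neg, neg_neg, div_mul_cancel₀ _ h]

/-- The curvature tensor at a point where the paraholomorphic sectional curvature is `k`. The section
determined by `e` excludes the case that the condition on `k` is empty. -/
theorem IsParaSasakian.hasCurvatureForm (hS : S.IsParaSasakian) {k : ℝ}
    (hk : ∀ v, S.DeterminesSection p v → S.paraholomorphicCurvature p v = k)
    {e : TangentSpace (𝓡 (2 * n + 1)) p} (he : S.DeterminesSection p e) :
    S.HasCurvatureForm p k := fun x y z w ↦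
  (S.isParacontact p).eq_paraCurvatureForm (S.g.isAlgCurvature_curvature p)
    hS.curvature_xi hS.curvature_phi
    (fun v hv ↦ (curvature_section hv).trans (by rw [hk v hv])) he x y z w

end ParacontactMetricStructure

end ParaSasakianCurvature

/-! ### Algebra of Schur's lemma -/

section SchurAlgebra

variable {V : Type*} [AddCommGroup V] [Module ℝ V]

namespace IsParacontact

variable {g : V → V → ℝ} {φ : V → V} {ξ : V} {η : V → ℝ} (P : IsParacontact g φ ξ η)
include P

/-- If all vectors `φe` were isotropic, then `g(u, v) = η(u)η(v)` by polarization, and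
nondegeneracy would make `ξ` span the space. -/
theorem exists_nonisotropic (hV : 1 < Module.finrank ℝ V) : ∃ e, g (φ e) (φ e) ≠ 0 := by
  by_contra! h
  have h0 : ∀ u v, g (φ u) (φ v) = 0 := by
    intro u v
    have := h (u + v)
    rw [P.φ_add, P.g_add, P.g_add_right, P.g_add_right, h, h, P.g_symm (φ v) (φ u)] at this
    linarith
  have h1 : ∀ u, η u • ξ = u := by
    refine fun u ↦ P.g_ext _ _ fun v ↦ ?_
    have := P.g_φ_φ u v
    rw [h0] at this
    rw [P.g_smul, P.ξ_g]
    linarith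
  exact absurd (finrank_le_one ξ fun u ↦ ⟨η u, h1 u⟩) (by omega)

/-- A paraholomorphic section that is nondegenerate has, in dimension at least four, another one
orthogonal to it. -/
theorem exists_nonisotropic_orthogonal (hV : 3 < Module.finrank ℝ V) {u : V} (hu : η u = 0)
    (hu' : g u u ≠ 0) : ∃ e, g (φ e) (φ e) ≠ 0 ∧ g (φ e) u = 0 ∧ g (φ e) (φ u) = 0 := by
  have hφu : g (φ u) (φ u) = -g u u := by rw [P.g_φ_φ, hu]; ring
  by_contra! h
  let H : V → Prop := fun v ↦ η v = 0 ∧ g v u = 0 ∧ g v (φ u) = 0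
  have h0 : ∀ v, H v → g v v = 0 := by
    rintro v ⟨h1, h2, h3⟩
    by_contra h4
    have e : φ (φ v) = v := by rw [P.φ_φ, h1, zero_smul, sub_zero]
    exact h (φ v) (by rwa [e]) (by rwa [e]) (by rwa [e])
  have h1 : ∀ v w, H v → H w → g v w = 0 := by
    intro v w hv hw
    have := h0 (v + w) ⟨by rw [P.η_add, hv.1, hw.1, add_zero],
      by rw [P.g_add, hv.2.1, hw.2.1, add_zero], by rw [P.g_add, hv.2.2, hw.2.2, add_zero]⟩
    rw [P.g_add, P.g_add_right, P.g_add_right, h0 v hv, h0 w hw, P.g_symm w v] at this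
    linarith
  -- the orthogonal projection along the span of `ξ`, `u` and `φu`
  let proj : V → V := fun v ↦ v - (η v • ξ + (g v u / g u u) • u - (g v (φ u) / g u u) • φ u)
  have hproj : ∀ v, H (proj v) := by
    intro v
    have hη : η (proj v) = 0 := by
      rw [← P.g_ξ]
      simp only [proj, P.g_sub, P.g_add, P.g_smul, P.g_ξ, P.η_ξ, P.η_φ, hu]
      ring
    refine ⟨hη, ?_, ?_⟩
    · simp only [proj, P.g_sub, P.g_add, P.g_smul, P.ξ_g, P.g_φ_left, P.g_φ_self, hu]
      field_simp
      ring
    · simp only [proj, P.g_sub, P.g_add, P.g_smul, P.ξ_g, P.η_φ, P.g_φ_self, hφu]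
      field_simp
      ring
  have h2 : ∀ v, proj v = 0 := by
    refine fun v ↦ P.g_ext _ _ fun w ↦ ?_
    have e := h1 _ _ (hproj v) (hproj w)
    have e' : g (proj v) (proj w) = g (proj v) w := by
      obtain ⟨a1, a2, a3⟩ := hproj v
      have : ∀ a, a = proj v → g a (proj w) = g a w := by
        rintro a rfl
        change g (proj v) (w - (η w • ξ + (g w u / g u u) • u - (g w (φ u) / g u u) • φ u)) = _
        rw [P.g_sub_right, P.g_sub_right, P.g_add_right, P.g_smul_right, P.g_smul_right,
          P.g_smul_right, P.g_ξ, a1, a2, a3]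
        ring
      exact this _ rfl
    rw [← e', e, P.g_zero_left]
  have hspan : Submodule.span ℝ (({ξ, u, φ u} : Set V)) = ⊤ := by
    refine eq_top_iff.2 fun v _ ↦ ?_
    have hv : v = η v • ξ + (g v u / g u u) • u - (g v (φ u) / g u u) • φ u := sub_eq_zero.1 (h2 v)
    have m : ∀ {a}, a ∈ ({ξ, u, φ u} : Set V) → a ∈ Submodule.span ℝ ({ξ, u, φ u} : Set V) :=
      fun h ↦ Submodule.subset_span h
    rw [hv]
    exact sub_mem (add_mem (Submodule.smul_mem _ _ (m (by simp))) (Submodule.smul_mem _ _ (m (by simp))))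
      (Submodule.smul_mem _ _ (m (by simp)))
  classical
  have h3 := finrank_span_finset_le_card (R := ℝ) ({ξ, u, φ u} : Finset V)
  have h4 : (({ξ, u, φ u} : Finset V) : Set V) = {ξ, u, φ u} := by simp
  have h5 : ({ξ, u, φ u} : Finset V).card ≤ 3 := Finset.card_le_three
  rw [h4, Set.finrank, hspan, finrank_top] at h3
  omega

/-- The algebra behind Schur's lemma: a covector `d` is zero if the cyclic sum of `d ⊗ T` over the
first three arguments vanishes, where `T` is the coefficient of `k` in the curvature tensor of
constant paraholomorphic sectional curvature `k`. -/
theorem eq_zero_of_cyclic_sum (hV : 3 < Module.finrank ℝ V) {d : V → ℝ}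
    (d_add : ∀ x y, d (x + y) = d x + d y) (d_smul : ∀ (c : ℝ) x, d (c • x) = c * d x)
    {T : V → V → V → V → ℝ}
    (hT : ∀ x y z w, T x y z w = paraCurvatureForm g φ η 1 x y z w - paraCurvatureForm g φ η 0 x y z w)
    (hd : ∀ u x y z w, d u * T x y z w + d x * T y u z w + d y * T u x z w = 0) (x : V) :
    d x = 0 := by
  obtain ⟨e, he⟩ := P.exists_nonisotropic (by omega)
  have diag : ∀ v, T (φ v) (φ (φ v)) (φ (φ v)) (φ v) = -g (φ v) (φ v) ^ 2 := by
    intro v; rw [hT, P.form_diag, P.form_diag]; ring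
  -- vectors orthogonal to a nondegenerate section are annihilated by `d`
  have key : ∀ u v, g (φ v) (φ v) ≠ 0 → g (φ v) u = 0 → g (φ v) (φ u) = 0 → d u = 0 := by
    intro u v hv h1 h2
    have h3 : g (φ (φ v)) u = 0 := by rw [P.g_φ_left, h2, neg_zero]
    have h4 : g (φ (φ v)) (φ u) = 0 := by rw [P.g_φ_φ, h1, P.η_φ]; ring
    have h5 := hd u (φ v) (φ (φ v)) (φ (φ v)) (φ v)
    have h1' : g u (φ v) = 0 := by rw [P.g_symm, h1]
    have h3' : g u (φ (φ v)) = 0 := by rw [P.g_symm, h3]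
    have a1 : T (φ (φ v)) u (φ (φ v)) (φ v) = 0 := by
      rw [hT]
      simp only [paraCurvatureForm, P.η_φ, P.φ_φ_φ, h1, h3, h4, h1', h3']
      ring
    have a2 : T u (φ v) (φ (φ v)) (φ v) = 0 := by
      rw [hT]
      simp only [paraCurvatureForm, P.η_φ, h1, h3, h4, h1', h3']
      ring
    rw [diag, a1, a2] at h5
    have h6 : d u * g (φ v) (φ v) ^ 2 = 0 := by linarith
    exact (mul_eq_zero.1 h6).resolve_right (pow_ne_zero 2 hv)
  have dξ : d ξ = 0 := key ξ e he (by rw [P.g_ξ, P.η_φ]) (by rw [P.φ_ξ, P.g_zero_right])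
  -- for isotropic `φx`, by continuity along a line through `φx` in a nonisotropic direction
  have dφ : ∀ x, d (φ x) = 0 := by
    refine eq_zero_of_quadratic_ne_zero (q := fun u ↦ g (φ u) (φ u))
      (b := fun u v ↦ 2 * g (φ u) (φ v)) (f := fun u ↦ d (φ u)) (fun u v ↦ ?_)
      (fun u v t ↦ ?_) (fun u hu ↦ ?_) he
    · simp only [P.φ_add, P.φ_smul, d_add, d_smul]
      fun_prop
    · simp only [P.φ_add, P.φ_smul, P.g_add, P.g_smul, P.g_add_right, P.g_smul_right]
      rw [P.g_symm (φ v) (φ u)]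
      ring
    · obtain ⟨v, h1, h2, h3⟩ := P.exists_nonisotropic_orthogonal hV (P.η_φ u) hu
      exact key _ v h1 h2 h3
  have hx : x = φ (φ x) + η x • ξ := by rw [P.φ_φ, sub_add_cancel]
  rw [hx, d_add, d_smul, dφ, dξ]
  ring

/-- The part of the covariant derivative in the direction `u` of the curvature tensor of constant
paraholomorphic sectional curvature `k` which comes from `∇η` and `∇φ`. -/
def _root_.paraCurvatureFormDeriv (g : V → V → ℝ) (φ : V → V) (η : V → ℝ) (k : ℝ) (u x y z w : V) : ℝ :=
  (k + 1) / 4 * (g z x * (g u (φ y) * η w + η y * g u (φ w))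
    + g w y * (g u (φ x) * η z + η x * g u (φ z)) - g w x * (g u (φ y) * η z + η y * g u (φ z))
    - g z y * (g u (φ w) * η x + η w * g u (φ x))
    + ((η y * g z u - g u y * η z) * g x (φ w) + g z (φ y) * (η w * g x u - g u w * η x))
    - ((η x * g z u - g u x * η z) * g y (φ w) + g z (φ x) * (η w * g y u - g u w * η y))
    + 2 * ((η y * g x u - g u y * η x) * g z (φ w) + g x (φ y) * (η w * g z u - g u w * η z)))

/-- These terms do not contribute to the second Bianchi identity. -/
theorem formDeriv_cyclic_sum (k : ℝ) (u x y z w : V) :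
    paraCurvatureFormDeriv g φ η k u x y z w + paraCurvatureFormDeriv g φ η k x y u z w
      + paraCurvatureFormDeriv g φ η k y u x z w = 0 := by
  simp only [paraCurvatureFormDeriv]
  rw [P.g_symm x u, P.g_symm y u, P.g_symm z u, P.g_symm w u, P.g_symm y x, P.g_symm z x,
    P.g_symm w x, P.g_symm z y, P.g_symm w y, P.g_φ_comm x u, P.g_φ_comm y u, P.g_φ_comm z u,
    P.g_φ_comm y x, P.g_φ_comm z x, P.g_φ_comm z y]
  ring

end IsParacontact

end SchurAlgebra

/-! ### The second Bianchi identity -/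

section SecondBianchi
open Filter

variable {m : ℕ} {M : Type*} [TopologicalSpace M] [ChartedSpace (EuclideanSpace ℝ (Fin m)) M]
  [IsManifold (𝓡 m) ∞ M]

namespace PseudoRiemannianMetric

variable (g : PseudoRiemannianMetric m M)
variable {X Y Z W : Π q : M, TangentSpace (𝓡 m) q} {p : M}

theorem contMDiffAt_curvatureOperator (hX : ContMDiffAt (𝓡 m) (𝓡 m).tangent ∞ (T% X) p)
    (hY : ContMDiffAt (𝓡 m) (𝓡 m).tangent ∞ (T% Y) p)
    (hZ : ContMDiffAt (𝓡 m) (𝓡 m).tangent ∞ (T% Z) p) :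
    ContMDiffAt (𝓡 m) (𝓡 m).tangent ∞ (T% (g.curvatureOperator X Y Z)) p :=
  ((g.contMDiffAt_leviCivita hX (g.contMDiffAt_leviCivita hY hZ)).sub_section
    (g.contMDiffAt_leviCivita hY (g.contMDiffAt_leviCivita hX hZ))).sub_section
    (g.contMDiffAt_leviCivita (hX.mlieBracket_infty hY) hZ)

/-- The second Bianchi identity, for the commuting extensions of three tangent vectors; it is
the Jacobi identity for the operators `∇_U`, `∇_X`, `∇_Y`. -/
theorem leviCivita_curvatureOperator_cyclic_sum (u x y z : TangentSpace (𝓡 m) p) :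
    (g.leviCivita (coordField u) (g.curvatureOperator (coordField x) (coordField y) (coordField z)) p
      - g.curvatureOperator (coordField x) (coordField y)
        (g.leviCivita (coordField u) (coordField z)) p)
    + (g.leviCivita (coordField x) (g.curvatureOperator (coordField y) (coordField u) (coordField z)) p
      - g.curvatureOperator (coordField y) (coordField u)
        (g.leviCivita (coordField x) (coordField z)) p)
    + (g.leviCivita (coordField y) (g.curvatureOperator (coordField u) (coordField x) (coordField z)) p
      - g.curvatureOperator (coordField u) (coordField x)
        (g.leviCivita (coordField y) (coordField z)) p) = 0 := by
  have hs := fun v : TangentSpace (𝓡 m) p ↦ contMDiffAt_coordField v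
  have hc := fun v w : TangentSpace (𝓡 m) p ↦ mlieBracket_coordField v w
  have h1 : ∀ a b c : TangentSpace (𝓡 m) p,
      g.leviCivita (coordField a)
        (g.curvatureOperator (coordField b) (coordField c) (coordField z)) p =
      g.leviCivita (coordField a) (g.leviCivita (coordField b)
        (g.leviCivita (coordField c) (coordField z))) p
      - g.leviCivita (coordField a) (g.leviCivita (coordField c)
        (g.leviCivita (coordField b) (coordField z))) p := by
    intro a b c
    have e : g.curvatureOperator (coordField b) (coordField c) (coordField z) =ᶠ[𝓝 p]
        g.leviCivita (coordField b) (g.leviCivita (coordField c) (coordField z))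
        - g.leviCivita (coordField c) (g.leviCivita (coordField b) (coordField z)) := by
      filter_upwards [eventually_eventually_nhds.2 (hc b c), eventually_contMDiffAt_coordField z]
        with q h1 h2
      exact g.curvatureOperator_of_commute h2 h1
    rw [g.leviCivita_congr_right _ e, g.leviCivita_sub_right (hs a).mdiff_infty
      (g.contMDiffAt_leviCivita (hs b) (g.contMDiffAt_leviCivita (hs c) (hs z))).mdiff_infty
      (g.contMDiffAt_leviCivita (hs c) (g.contMDiffAt_leviCivita (hs b) (hs z))).mdiff_infty]
  have h2 : ∀ a b c : TangentSpace (𝓡 m) p,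
      g.curvatureOperator (coordField b) (coordField c)
        (g.leviCivita (coordField a) (coordField z)) p =
      g.leviCivita (coordField b) (g.leviCivita (coordField c)
        (g.leviCivita (coordField a) (coordField z))) p
      - g.leviCivita (coordField c) (g.leviCivita (coordField b)
        (g.leviCivita (coordField a) (coordField z))) p := fun a b c ↦
    g.curvatureOperator_of_commute (g.contMDiffAt_leviCivita (hs a) (hs z)) (hc b c)
  rw [h1, h1, h1, h2, h2, h2]
  abel

end PseudoRiemannianMetric

end SecondBianchi

/-! ### Directional derivatives -/

section DirectionalDerivative

variable {m : ℕ} {M : Type*} [TopologicalSpace M] [ChartedSpace (EuclideanSpace ℝ (Fin m)) M]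
variable {f f' : M → ℝ} {p : M} {u : TangentSpace (𝓡 m) p} {a a' : ℝ}

/-- The function `f` is differentiable at `p`, and its derivative in the direction `u` is `a`. -/
def HasDirDeriv (f : M → ℝ) (p : M) (u : TangentSpace (𝓡 m) p) (a : ℝ) : Prop :=
  MDifferentiableAt (𝓡 m) 𝓘(ℝ, ℝ) f p ∧ mvfderiv (𝓡 m) f p u = a

namespace HasDirDeriv

theorem const (c : ℝ) : HasDirDeriv (fun _ : M ↦ c) p u 0 :=
  ⟨mdifferentiableAt_const, by rw [mvfderiv_const, zero_apply]⟩

theorem add (h : HasDirDeriv f p u a) (h' : HasDirDeriv f' p u a') :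
    HasDirDeriv (fun q ↦ f q + f' q) p u (a + a') :=
  ⟨h.1.add h'.1, by rw [mvfderiv_fun_add h.1 h'.1, add_apply, h.2, h'.2]⟩

theorem sub (h : HasDirDeriv f p u a) (h' : HasDirDeriv f' p u a') :
    HasDirDeriv (fun q ↦ f q - f' q) p u (a - a') :=
  ⟨h.1.sub h'.1, by rw [mvfderiv_fun_sub h.1 h'.1, sub_apply, h.2, h'.2]⟩

theorem mul (h : HasDirDeriv f p u a) (h' : HasDirDeriv f' p u a') :
    HasDirDeriv (fun q ↦ f q * f' q) p u (a * f' p + f p * a') :=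
  ⟨h.1.mul h'.1, by
    rw [mvfderiv_fun_mul h.1 h'.1, add_apply, smul_apply, smul_apply, h.2, h'.2, smul_eq_mul,
      smul_eq_mul]
    ring⟩

end HasDirDeriv

end DirectionalDerivative

/-! ### The derivative of the curvature form -/

section Schur
open Filter

variable {n : ℕ} {M : Type*} [TopologicalSpace M]
  [ChartedSpace (EuclideanSpace ℝ (Fin (2 * n + 1))) M] [IsManifold (𝓡 (2 * n + 1)) ∞ M]

namespace ParacontactMetricStructure

/-- The curvature tensor of constant paraholomorphic sectional curvature `k` at the point `p`. -/
abbrev curvatureForm (S : ParacontactMetricStructure n M) (k : ℝ) (p : M)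
    (x y z w : TangentSpace (𝓡 (2 * n + 1)) p) : ℝ :=
  paraCurvatureForm (fun u v ↦ S.g.inner p u v) (fun v ↦ S.φ p v) (fun v ↦ S.η p v) k x y z w

variable {S : ParacontactMetricStructure n M} (hS : S.IsParaSasakian) {k : M → ℝ} {p : M}
include hS

/-- The derivative of the fundamental form. -/
theorem IsParaSasakian.hasDirDeriv_inner_phi {X Y U : Π q : M, TangentSpace (𝓡 (2 * n + 1)) q}
    (hU : ContMDiffAt (𝓡 (2 * n + 1)) (𝓡 (2 * n + 1)).tangent ∞ (T% U) p)
    (hX : ContMDiffAt (𝓡 (2 * n + 1)) (𝓡 (2 * n + 1)).tangent ∞ (T% X) p)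
    (hY : ContMDiffAt (𝓡 (2 * n + 1)) (𝓡 (2 * n + 1)).tangent ∞ (T% Y) p) :
    HasDirDeriv (fun q ↦ S.g.inner q (X q) (S.φ q (Y q))) p (U p)
      (S.g.inner p (S.g.leviCivita U X p) (S.φ p (Y p))
        + S.g.inner p (X p) (S.φ p (S.g.leviCivita U Y p))
        + (S.η p (Y p) * S.g.inner p (X p) (U p) - S.g.inner p (U p) (Y p) * S.η p (X p))) := by
  have h := S.contMDiffAt_phiField hY
  refine ⟨S.g.mdifferentiableAt_inner hX.mdiff_infty h.mdiff_infty,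
    (S.g.mvfderiv_inner hU.mdiff_infty hX.mdiff_infty h.mdiff_infty).trans ?_⟩
  rw [hS.nabla_phi hU hY, phiField]
  simp only [map_add, map_sub, map_smul, smul_eq_mul, S.inner_ξ]
  ring

/-- The derivative of the curvature tensor of constant paraholomorphic sectional curvature `k`,
evaluated on vector fields, where `k` is a function. -/
theorem IsParaSasakian.mvfderiv_curvatureForm (hk : MDifferentiableAt (𝓡 (2 * n + 1)) 𝓘(ℝ, ℝ) k p)
    {U X Y Z W : Π q : M, TangentSpace (𝓡 (2 * n + 1)) q}
    (hU : ContMDiffAt (𝓡 (2 * n + 1)) (𝓡 (2 * n + 1)).tangent ∞ (T% U) p)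
    (hX : ContMDiffAt (𝓡 (2 * n + 1)) (𝓡 (2 * n + 1)).tangent ∞ (T% X) p)
    (hY : ContMDiffAt (𝓡 (2 * n + 1)) (𝓡 (2 * n + 1)).tangent ∞ (T% Y) p)
    (hZ : ContMDiffAt (𝓡 (2 * n + 1)) (𝓡 (2 * n + 1)).tangent ∞ (T% Z) p)
    (hW : ContMDiffAt (𝓡 (2 * n + 1)) (𝓡 (2 * n + 1)).tangent ∞ (T% W) p) :
    mvfderiv (𝓡 (2 * n + 1)) (fun q ↦ S.curvatureForm (k q) q (X q) (Y q) (Z q) (W q)) p (U p) =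
      mvfderiv (𝓡 (2 * n + 1)) k p (U p) * (S.curvatureForm 1 p (X p) (Y p) (Z p) (W p)
        - S.curvatureForm 0 p (X p) (Y p) (Z p) (W p))
      + S.curvatureForm (k p) p (S.g.leviCivita U X p) (Y p) (Z p) (W p)
      + S.curvatureForm (k p) p (X p) (S.g.leviCivita U Y p) (Z p) (W p)
      + S.curvatureForm (k p) p (X p) (Y p) (S.g.leviCivita U Z p) (W p)
      + S.curvatureForm (k p) p (X p) (Y p) (Z p) (S.g.leviCivita U W p)
      + paraCurvatureFormDeriv (fun u v ↦ S.g.inner p u v) (fun v ↦ S.φ p v) (fun v ↦ S.η p v)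
          (k p) (U p) (X p) (Y p) (Z p) (W p) := by
  have dg : ∀ {A B : Π q : M, TangentSpace (𝓡 (2 * n + 1)) q},
      ContMDiffAt (𝓡 (2 * n + 1)) (𝓡 (2 * n + 1)).tangent ∞ (T% A) p →
      ContMDiffAt (𝓡 (2 * n + 1)) (𝓡 (2 * n + 1)).tangent ∞ (T% B) p →
      HasDirDeriv (fun q ↦ S.g.inner q (A q) (B q)) p (U p)
        (S.g.inner p (S.g.leviCivita U A p) (B p) + S.g.inner p (A p) (S.g.leviCivita U B p)) :=
    fun hA hB ↦ ⟨S.g.mdifferentiableAt_inner hA.mdiff_infty hB.mdiff_infty,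
      S.g.mvfderiv_inner hU.mdiff_infty hA.mdiff_infty hB.mdiff_infty⟩
  have dη : ∀ {A : Π q : M, TangentSpace (𝓡 (2 * n + 1)) q},
      ContMDiffAt (𝓡 (2 * n + 1)) (𝓡 (2 * n + 1)).tangent ∞ (T% A) p →
      HasDirDeriv (fun q ↦ S.η q (A q)) p (U p)
        (S.g.inner p (U p) (S.φ p (A p)) + S.η p (S.g.leviCivita U A p)) :=
    fun hA ↦ ⟨(S.contMDiffAt_eta hA).mdifferentiableAt (by simp), hS.mvfderiv_eta hU hA⟩
  have dΦ := fun {A B : Π q : M, TangentSpace (𝓡 (2 * n + 1)) q}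
    (hA : ContMDiffAt (𝓡 (2 * n + 1)) (𝓡 (2 * n + 1)).tangent ∞ (T% A) p)
    (hB : ContMDiffAt (𝓡 (2 * n + 1)) (𝓡 (2 * n + 1)).tangent ∞ (T% B) p) ↦
    hS.hasDirDeriv_inner_phi hU hA hB
  have dk : HasDirDeriv k p (U p) (mvfderiv (𝓡 (2 * n + 1)) k p (U p)) := ⟨hk, rfl⟩
  have dc := fun c : ℝ ↦ HasDirDeriv.const (p := p) (u := U p) c
  have d1 := ((dk.sub (dc 3)).mul (dc 4⁻¹)).mul
    (((dg hX hW).mul (dg hZ hY)).sub ((dg hY hW).mul (dg hZ hX)))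
  have d2 := ((((((((dg hZ hX).mul (dη hY)).mul (dη hW)).add
    (((dg hW hY).mul (dη hX)).mul (dη hZ))).sub
    (((dg hW hX).mul (dη hY)).mul (dη hZ))).sub
    (((dg hZ hY).mul (dη hW)).mul (dη hX))).add
    ((dΦ hZ hY).mul (dΦ hX hW))).sub
    ((dΦ hZ hX).mul (dΦ hY hW))).add
    (((dc 2).mul (dΦ hX hY)).mul (dΦ hZ hW))
  have d := d1.add (((dk.add (dc 1)).mul (dc 4⁻¹)).mul d2)
  refine d.2.trans ?_
  simp only [paraCurvatureForm, paraCurvatureFormDeriv]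
  ring

end ParacontactMetricStructure

end Schur

/-! ### Functions with vanishing derivative -/

section LocallyConstant
open Filter

variable {m : ℕ} {M : Type*} [TopologicalSpace M] [ChartedSpace (EuclideanSpace ℝ (Fin m)) M]
  [IsManifold (𝓡 m) ∞ M]

theorem isLocallyConstant_of_mvfderiv_eq_zero {k : M → ℝ}
    (hk : ∀ p, MDifferentiableAt (𝓡 m) 𝓘(ℝ, ℝ) k p)
    (h0 : ∀ (p : M) (u : TangentSpace (𝓡 m) p), mvfderiv (𝓡 m) k p u = 0) : IsLocallyConstant k := by
  have := IsManifold.of_le (I := 𝓡 m) (M := M) (m := 1) (n := ∞) (by simp)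
  refine (IsLocallyConstant.iff_eventually_eq k).2 fun p ↦ ?_
  have hd : ∀ y ∈ (extChartAt (𝓡 m) p).target, HasFDerivAt
      (k ∘ (extChartAt (𝓡 m) p).symm) (0 : EuclideanSpace ℝ (Fin m) →L[ℝ] ℝ) y := by
    intro y hy
    have h1 := mdifferentiableWithinAt_extChartAt_symm (I := 𝓡 m) hy
    rw [ModelWithCorners.Boundaryless.range_eq_univ, mdifferentiableWithinAt_univ] at h1
    have h2 := (hk ((extChartAt (𝓡 m) p).symm y)).hasMFDerivAt
    have h3 : mfderiv (𝓡 m) 𝓘(ℝ, ℝ) k ((extChartAt (𝓡 m) p).symm y) = 0 := by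
      ext u
      exact h0 _ u
    rw [h3] at h2
    have h4 := (h2.comp y h1.hasMFDerivAt).hasFDerivAt
    have e : ((0 : TangentSpace (𝓡 m) ((extChartAt (𝓡 m) p).symm y) →L[ℝ]
        TangentSpace 𝓘(ℝ, ℝ) (k ((extChartAt (𝓡 m) p).symm y))).comp
        (mfderiv (𝓡 m) (𝓡 m) (extChartAt (𝓡 m) p).symm y)) = 0 := ContinuousLinearMap.zero_comp _
    rw [e] at h4
    exact h4
  have ho := (isOpen_extChartAt_target (I := 𝓡 m) p).isOpen_inter_preimage_of_fderiv_eq_zero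
    (fun y hy ↦ (hd y hy).differentiableAt.differentiableWithinAt) (fun y hy ↦ (hd y hy).fderiv) {k p}
  have hmem := ho.mem_nhds (x := extChartAt (𝓡 m) p p) ⟨mem_extChartAt_target p, by simp⟩
  filter_upwards [(continuousAt_extChartAt (I := 𝓡 m) p).eventually hmem,
    extChartAt_source_mem_nhds (I := 𝓡 m) p] with q h1 h2
  have := h1.2
  rwa [Set.mem_preimage, Function.comp_apply, (extChartAt (𝓡 m) p).left_inv h2,
    Set.mem_singleton_iff] at this

end LocallyConstant

/-! ### Schur's lemma for paraSasakian manifolds -/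

section Schur
open Filter

variable {n : ℕ} {M : Type*} [TopologicalSpace M]
  [ChartedSpace (EuclideanSpace ℝ (Fin (2 * n + 1))) M] [IsManifold (𝓡 (2 * n + 1)) ∞ M]

namespace ParacontactMetricStructure

variable {S : ParacontactMetricStructure n M} {k : M → ℝ} {p : M}

omit [IsManifold (𝓡 (2 * n + 1)) ∞ M] in
theorem finrank_tangentSpace (p : M) :
    Module.finrank ℝ (TangentSpace (𝓡 (2 * n + 1)) p) = 2 * n + 1 :=
  finrank_euclideanSpace_fin (𝕜 := ℝ)

theorem exists_determinesSection (hn : 1 < n) (p : M) : ∃ e, S.DeterminesSection p e :=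
  (S.isParacontact p).exists_nonisotropic (by rw [finrank_tangentSpace]; omega)

/-- The function giving the paraholomorphic sectional curvatures is smooth: near `p` it is the
curvature of the sections determined by a smooth vector field. -/
theorem contMDiffAt_paraholomorphicCurvature (hn : 1 < n)
    (hk : ∀ p v, S.DeterminesSection p v → S.paraholomorphicCurvature p v = k p) :
    ContMDiffAt (𝓡 (2 * n + 1)) 𝓘(ℝ, ℝ) ∞ k p := by
  obtain ⟨e, he⟩ := exists_determinesSection (S := S) hn p
  set X := S.phiField (coordField e) with hX
  set Y := S.phiField X with hY
  have sX : ContMDiffAt (𝓡 (2 * n + 1)) (𝓡 (2 * n + 1)).tangent ∞ (T% X) p :=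
    S.contMDiffAt_phiField (contMDiffAt_coordField e)
  have sY : ContMDiffAt (𝓡 (2 * n + 1)) (𝓡 (2 * n + 1)).tangent ∞ (T% Y) p :=
    S.contMDiffAt_phiField sX
  have h0 : S.g.inner p (X p) (X p) ≠ 0 := by
    rw [hX, phiField, coordField_self]
    exact he
  have sg := S.g.contMDiffAt_inner sX sX
  have sR := S.g.contMDiffAt_inner (S.g.contMDiffAt_curvatureOperator sX sY sY) sX
  refine ((sR.neg).mul ((sg.pow 2).inv₀ (pow_ne_zero 2 h0))).congr_of_eventuallyEq ?_
  filter_upwards [eventually_contMDiffAt_coordField e, sg.continuousAt.eventually_ne h0] with q h1 h2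
  have h3 : S.DeterminesSection q (coordField e q) := h2
  have h4 := curvature_section h3
  have h5 := S.contMDiffAt_phiField h1
  have h6 := S.contMDiffAt_phiField h5
  have h7 := S.g.curvature_eq h5 h6 h6 (X q)
  rw [hk q _ h3] at h4
  have h8 := h7.symm.trans h4
  have h9 : S.g.inner q (X q) (X q) ^ 2 ≠ 0 := pow_ne_zero 2 h2
  have h10 : k q = -(S.g.inner q (S.g.curvatureOperator X Y Y q) (X q)) *
      (S.g.inner q (X q) (X q) ^ 2)⁻¹ := by
    rw [eq_mul_inv_iff_mul_eq₀ h9]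
    change S.g.inner q (S.g.curvatureOperator X Y Y q) (X q) =
      -k q * S.g.inner q (X q) (X q) ^ 2 at h8
    rw [h8]
    ring
  exact h10

/-- Schur's lemma: if the curvature tensor has the form of constant paraholomorphic sectional
curvature `k q` at every point `q`, the second Bianchi identity forces `dk = 0`. -/
theorem IsParaSasakian.mvfderiv_eq_zero (hS : S.IsParaSasakian) (hn : 1 < n)
    (hk : MDifferentiableAt (𝓡 (2 * n + 1)) 𝓘(ℝ, ℝ) k p) (hF : ∀ q, S.HasCurvatureForm q (k q))
    (u : TangentSpace (𝓡 (2 * n + 1)) p) : mvfderiv (𝓡 (2 * n + 1)) k p u = 0 := by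
  have P := S.isParacontact p
  have hs := fun v : TangentSpace (𝓡 (2 * n + 1)) p ↦ contMDiffAt_coordField v
  have hv := fun v : TangentSpace (𝓡 (2 * n + 1)) p ↦ coordField_self v
  have hF' : ∀ (q : M) (x y z w : TangentSpace (𝓡 (2 * n + 1)) q),
      S.g.curvature q x y z w = S.curvatureForm (k q) q x y z w := fun q x y z w ↦ hF q x y z w
  -- the covariant derivative of the curvature tensor, computed from its explicit form
  have D : ∀ u x y z w : TangentSpace (𝓡 (2 * n + 1)) p,
      S.g.inner p (S.g.leviCivita (coordField u)
          (S.g.curvatureOperator (coordField x) (coordField y) (coordField z)) p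
        - S.g.curvatureOperator (coordField x) (coordField y)
          (S.g.leviCivita (coordField u) (coordField z)) p) w =
      mvfderiv (𝓡 (2 * n + 1)) k p u * (S.curvatureForm 1 p x y z w - S.curvatureForm 0 p x y z w)
      + S.curvatureForm (k p) p (S.g.leviCivita (coordField u) (coordField x) p) y z w
      + S.curvatureForm (k p) p x (S.g.leviCivita (coordField u) (coordField y) p) z w
      + paraCurvatureFormDeriv (fun u v ↦ S.g.inner p u v) (fun v ↦ S.φ p v) (fun v ↦ S.η p v)
          (k p) u x y z w := by
    intro u x y z w
    have sR := S.g.contMDiffAt_curvatureOperator (hs x) (hs y) (hs z)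
    have h1 := S.g.mvfderiv_inner (hs u).mdiff_infty sR.mdiff_infty (hs w).mdiff_infty
    have e : (fun q ↦ S.g.inner q (S.g.curvatureOperator (coordField x) (coordField y)
          (coordField z) q) (coordField w q)) =ᶠ[𝓝 p]
        fun q ↦ S.curvatureForm (k q) q (coordField x q) (coordField y q) (coordField z q)
          (coordField w q) := by
      filter_upwards [eventually_contMDiffAt_coordField x, eventually_contMDiffAt_coordField y,
        eventually_contMDiffAt_coordField z] with q h1 h2 h3
      rw [← S.g.curvature_eq h1 h2 h3, hF']
    have h2 := S.g.curvature_eq (hs x) (hs y) (hs z) (S.g.leviCivita (coordField u) (coordField w) p)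
    have h3 := S.g.curvature_eq (hs x) (hs y) (S.g.contMDiffAt_leviCivita (hs u) (hs z)) w
    rw [mvfderiv_congr_of_eventuallyEq e, hS.mvfderiv_curvatureForm hk (hs u) (hs x) (hs y) (hs z)
      (hs w), ← h2, hF'] at h1
    rw [hF'] at h3
    simp only [hv] at h1 h3
    rw [map_sub, sub_apply, ← h3]
    linarith
  refine P.eq_zero_of_cyclic_sum (by rw [finrank_tangentSpace]; omega)
    (d := fun u ↦ mvfderiv (𝓡 (2 * n + 1)) k p u) (fun x y ↦ map_add _ _ _)
    (fun c x ↦ (map_smul _ _ _).trans (smul_eq_mul _ _))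
    (T := fun x y z w ↦ S.curvatureForm 1 p x y z w - S.curvatureForm 0 p x y z w)
    (fun x y z w ↦ rfl) (fun u x y z w ↦ ?_) u
  have sw : ∀ x y : TangentSpace (𝓡 (2 * n + 1)) p,
      S.g.leviCivita (coordField x) (coordField y) p = S.g.leviCivita (coordField y) (coordField x) p :=
    fun x y ↦ (S.g.leviCivita_comm_of_commute (hs x) (hs y) (mlieBracket_coordField x y)).self_of_nhds
  have B := congrArg (fun v ↦ S.g.inner p v w) (S.g.leviCivita_curvatureOperator_cyclic_sum u x y z)
  simp only [map_add, add_apply, map_zero, zero_apply, D] at B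
  have E := P.formDeriv_cyclic_sum (k p) u x y z w
  have A := fun a b ↦ (P.isAlgCurvature_form (k p)).swap_left a b z w
  have A1 := A (S.g.leviCivita (coordField u) (coordField x) p) y
  have A2 := A (S.g.leviCivita (coordField u) (coordField y) p) x
  have A3 := A (S.g.leviCivita (coordField x) (coordField y) p) u
  rw [sw x u, sw y u, sw y x] at B
  linarith

end ParacontactMetricStructure

end Schur

end

theorem theorem4p2 (n : ℕ) (hn : 1 < n) {M : Type*} [TopologicalSpace M] [T2Space M]
    [ChartedSpace (EuclideanSpace ℝ (Fin (2 * n + 1))) M] [IsManifold (𝓡 (2 * n + 1)) ∞ M]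
    (S : ParacontactMetricStructure n M) (hS : S.IsParaSasakian) :
    (∀ p : M, S.IndependentOfSection p →
      ∃ k : ℝ, (∀ v, S.DeterminesSection p v → S.paraholomorphicCurvature p v = k) ∧
        S.HasCurvatureForm p k) ∧
    ((∀ p : M, S.IndependentOfSection p) →
      ∃ k : M → ℝ, IsLocallyConstant k ∧
        (ConnectedSpace M → ∃ c : ℝ, ∀ p, k p = c) ∧
        ∀ p, (∀ v, S.DeterminesSection p v → S.paraholomorphicCurvature p v = k p) ∧
          S.HasCurvatureForm p (k p)) := by
  have pointwise : ∀ p : M, S.IndependentOfSection p →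
      ∃ k : ℝ, (∀ v, S.DeterminesSection p v → S.paraholomorphicCurvature p v = k) ∧
        S.HasCurvatureForm p k := by
    intro p hp
    obtain ⟨e, he⟩ := ParacontactMetricStructure.exists_determinesSection (S := S) hn p
    have hk := fun v hv ↦ hp v e hv he
    exact ⟨S.paraholomorphicCurvature p e, hk, hS.hasCurvatureForm hk he⟩
  refine ⟨pointwise, fun h ↦ ?_⟩
  choose k hk hF using fun p ↦ pointwise p (h p)
  have hd := fun p : M ↦ (ParacontactMetricStructure.contMDiffAt_paraholomorphicCurvature (p := p)
    hn hk).mdifferentiableAt (by simp)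
  have hlc : IsLocallyConstant k := isLocallyConstant_of_mvfderiv_eq_zero hd
    fun p u ↦ hS.mvfderiv_eq_zero hn (hd p) hF u
  refine ⟨k, hlc, fun hM ↦ ?_, fun p ↦ ⟨hk p, hF p⟩⟩
  obtain ⟨p⟩ := hM.toNonempty
  exact ⟨k p, fun q ↦ hlc.apply_eq_of_preconnectedSpace q p⟩
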